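/- **Setting.** Write $B_r(\theta)$ for the closed Euclidean ball in $\mathbb R^d$, $\operatorname{dist}(\cdot,S)$ for the distance to a set $S$, $\mathcal N_r(S)=\{\theta:\operatorname{dist}(\theta,S)\le r\}$, $\mathcal P_p(\mathbb R^d)$ for the Borel probability measures with finite $p$-th moment, $W_p$ for the Wasserstein-$p$ distance; $\mathcal C([0,T],\mathcal P_4(\mathbb R^d))$ denotes curves in $\mathcal P_4(\mathbb R^d)$ that are continuous for $W_4$. Let $L,G:\mathbb R^d\to\mathbb R$ be continuous, let $\Theta=\arg\min L$ and suppose: * (A1) there is a unique $\theta^*\in\Theta$ with $G(\theta^*)=\inf_\Theta G$ (this point $\theta^*$ is $\theta^*_{\rm good}$); put $\underline L=L(\theta^*)=\inf L$; * (A2) there are $h_L,R_L^H>0$, $H_L<\infty$ with $L(\theta)-\underline L\le H_L\|\theta-\theta^*\|^{h_L}$ on $B_{R_L^H}(\theta^*)$; * (A3) there are $L_\infty,R_L,\eta_L,\nu_L>0$ with $\operatorname{dist}(\theta,\Theta)\le\frac1{\eta_L}(L(\theta)-\underline L)^{\nu_L}$ on $\mathcal N_{R_L}(\Theta)$ and $L(\theta)-\underline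 L>L_\infty$ off $\mathcal N_{R_L}(\Theta)$; * (A4) there are $h_G,R_G^H>0$, $H_G<\infty$ with $G(\theta)-G(\theta^*)\le H_G\|\theta-\theta^*\|^{h_G}$ on $B_{R_G^H}(\theta^*)$; * (A5) there are $G_\infty,R_G,\eta_G,\nu_G>0$ such that for every $0<r_G\le R_G$ there is $\tilde\theta\in B_{r_G}(\theta^*)$ with $G(\theta)\ge G(\tilde\theta)$ and $\|\theta-\tilde\theta\|\le\frac1{\eta_G}(G(\theta)-G(\tilde\theta))^{\nu_G}$ on $B_{r_G}(\theta^*)$, and $G(\theta)-G(\tilde\theta)>G_\infty$ on $\mathcal N_{r_G}(\Theta)\setminus B_{r_G}(\theta^*)$; * (A6) there are $k_G,R_G^K,K_G>0$ with $G(\theta)-G(\theta^*)\ge K_G\|\theta-\theta^*\|^{k_G}$ on $\mathcal N_{R_G}(\Theta)\setminus B_{R_G^K}(\theta^*)$, where $R_G$ is the radius in (A5). For a probability measure $\varrho$ let $q_a[\varrho]=\inf\{q\in\mathbb R: a\le\varrho(L\le q)\}$, $$Q_\beta[\varrho]=\Big\{\theta\in B_R(0): L(\theta)\le\tfrac2\beta\int_{\beta/2}^\beta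 q_a[\varrho]\,da+\delta_q\Big\},\qquad m_{\alpha,\beta}[\varrho]=\frac{\int_{Q_\beta[\varrho]}\theta\,e^{-\alpha G(\theta)}\,d\varrho(\theta)}{\int_{Q_\beta[\varrho]}e^{-\alpha G(\theta)}\,d\varrho(\theta)} .$$ For weights $w_b>0$, $w_m\ge0$, $w_b+w_m=1$ put $\rho_t=w_b\rho^b_t+w_m\rho^m_t$. Given $\rho^m$, a curve $\rho^b\in\mathcal C([0,T],\mathcal P_4(\mathbb R^d))$ is a weak solution on $[0,T]$ with initial datum $\rho^b_0$ of $$\partial_t\rho^b_t=\lambda\operatorname{div}\big((\theta-m_{\alpha,\beta}[\rho_t])\rho^b_t\big)+\frac{\sigma^2}2\sum_{k=1}^d\partial_{kk}\big(\|\theta-m_{\alpha,\beta}[\rho_t]\|^2\rho^b_t\big)$$ if it starts at $\rho_0^b$ and for all $\varphi\in\mathcal C_c^\infty(\mathbb R^d)$, $t\in(0,T)$, $$\frac{d}{dt}\int\varphi\,d\rho^b_t=-\lambda\int\langle\theta-m_{\alpha,\beta}[\rho_t],\nabla\varphi\rangle\,d\rho^b_t+\frac{\sigma^2}2\int\|\theta-m_{\alpha,\beta}[\rho_t]\|^2\Delta\varphi\,d\rho^b_t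 .$$ **Theorem 2.2.** Let $\rho^b_0\in\mathcal P_4(\mathbb R^d)$ with $\theta^*\in\operatorname{supp}\rho^b_0$. Let $\varepsilon\in(0,W_2^2(\rho_0^b,\delta_{\theta^*})/2)$, $\vartheta\in(0,1)$, $\lambda,\sigma>0$ with $2\lambda>d\sigma^2$, and $$T^*=\frac1{(1-\vartheta)(2\lambda-d\sigma^2)}\log\frac{W_2^2(\rho_0^b,\delta_{\theta^*})}{2\varepsilon}.$$ There are $u>0$ and $\delta_0>0$ such that for all $\delta_q\in(0,\delta_0]$ and all $R>\|\theta^*\|$ there are $a,b>0$, none of $u,\delta_0,a,b$ depending on $w_b,w_m$, such that the following holds for all weights $w_b>0$, $w_m\ge0$ with $w_b+w_m=1$. Put $$\alpha_0=a+\frac1u\max\Big\{0,\log\Big(\frac{w_m}{w_b}\frac{R_G^K}{\sqrt\varepsilon}\Big)\Big\},\qquad \beta_0=b\,w_b$$ (the maximum being $0$ if $w_m=0$). If $\alpha>\alpha_0$, $0<\beta<\beta_0$, if $\rho^m\in\mathcal C([0,T^*],\mathcal P_4(\mathbb R^d))$ is arbitrary, if $\rho^b\in\mathcal C([0,T^*],\mathcal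 P_4(\mathbb R^d))$ is a weak solution of the above equation on $[0,T^*]$ with initial datum $\rho_0^b$, and if $t\mapsto m_{\alpha,\beta}[\rho_t]$ is continuous on $[0,T^*]$, then there is $$T\in\Big[\frac{1-\vartheta}{1+\vartheta/2}\,T^*,\,T^*\Big]\quad\text{with}\quad \tfrac12W_2^2(\rho^b_T,\delta_{\theta^*})=\varepsilon ,$$ and $W_2^2(\rho^b_t,\delta_{\theta^*})\le W_2^2(\rho^b_0,\delta_{\theta^*})\,e^{-(1-\vartheta)(2\lambda-d\sigma^2)t}$ for all $t\in[0,T]$. -/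

import Mathlib

open MeasureTheory Filter Topology Set
open scoped ENNReal ContDiff

namespace CB2O

noncomputable section

/-- The parameter space `ℝ^d` with the Euclidean norm. -/
abbrev E (d : ℕ) : Type := EuclideanSpace ℝ (Fin d)

/-! ### Probability measures and Wasserstein distances -/

/-- Membership in `𝒫_p(ℝ^d)`: a Borel probability measure with finite `p`-th moment. -/
def InP {d : ℕ} (p : ℕ) (μ : Measure (E d)) : Prop :=
  IsProbabilityMeasure μ ∧ Integrable (fun θ => ‖θ‖ ^ p) μ

/-- The set `Π(μ, ν)` of couplings of `μ` and `ν`. -/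
def couplings {d : ℕ} (μ ν : Measure (E d)) : Set (Measure (E d × E d)) :=
  {π | π.map Prod.fst = μ ∧ π.map Prod.snd = ν}

/-- The Wasserstein-`p` distance,
`W_p(μ, ν) = (inf over couplings π of ∫ ‖θ - θ'‖^p dπ(θ, θ'))^(1/p)`, with values in `[0, ∞]`. -/
def wasserstein {d : ℕ} (p : ℕ) (μ ν : Measure (E d)) : ℝ≥0∞ :=
  (⨅ π ∈ couplings μ ν, ∫⁻ z, ‖z.1 - z.2‖ₑ ^ p ∂π) ^ (1 / (p : ℝ))

/-- The real number `W_2²(μ, ν)` (the distance is finite on `𝒫_2`). -/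
def W2sq {d : ℕ} (μ ν : Measure (E d)) : ℝ := (wasserstein 2 μ ν).toReal ^ 2

/-- `ρ ∈ 𝒞([0,T], 𝒫_p(ℝ^d))`, where `𝒫_p` carries the distance `W_p`. Only the values of `ρ` on
`[0,T]` matter. -/
def ContinuousInP {d : ℕ} (p : ℕ) (T : ℝ) (ρ : ℝ → Measure (E d)) : Prop :=
  (∀ t ∈ Icc 0 T, InP p (ρ t)) ∧
    ∀ t ∈ Icc 0 T, Tendsto (fun s => wasserstein p (ρ s) (ρ t)) (𝓝[Icc 0 T] t) (𝓝 0)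

/-- The mixture `w_b ρ^b + w_m ρ^m`. -/
def mix {d : ℕ} (wb wm : ℝ) (ρb ρm : Measure (E d)) : Measure (E d) :=
  ENNReal.ofReal wb • ρb + ENNReal.ofReal wm • ρm

/-! ### The consensus point -/

/-- The `a`-quantile of `ϱ` under `L`: the smallest `q` with `a ≤ ϱ(L ≤ q)`. -/
def quantile {d : ℕ} (L : E d → ℝ) (ϱ : Measure (E d)) (a : ℝ) : ℝ :=
  sInf {q : ℝ | ENNReal.ofReal a ≤ ϱ {θ | L θ ≤ q}}

/-- The quantiled sub-level set `Q_β[ϱ]`. -/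
def subLevel {d : ℕ} (L : E d → ℝ) (β δq R : ℝ) (ϱ : Measure (E d)) : Set (E d) :=
  {θ | θ ∈ Metric.closedBall 0 R ∧ L θ ≤ 2 / β * (∫ a in (β / 2)..β, quantile L ϱ a) + δq}

/-- The Gibbs weight `ω_α = exp(-α G)`. -/
def gibbs {d : ℕ} (G : E d → ℝ) (α : ℝ) (θ : E d) : ℝ := Real.exp (-α * G θ)

/-- The measure `I_β[ϱ] = 1_{Q_β[ϱ]} ϱ`. -/
def quantiled {d : ℕ} (L : E d → ℝ) (β δq R : ℝ) (ϱ : Measure (E d)) : Measure (E d) :=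
  ϱ.restrict (subLevel L β δq R ϱ)

/-- The consensus point
`m_{α,β}[ϱ] = ∫ θ ω_α(θ) / ‖ω_α‖_{L¹(I_β[ϱ])} dI_β[ϱ](θ)`. -/
def consensus {d : ℕ} (L G : E d → ℝ) (α β δq R : ℝ) (ϱ : Measure (E d)) : E d :=
  ∫ θ, (gibbs G α θ / ∫ θ', ‖gibbs G α θ'‖ ∂(quantiled L β δq R ϱ)) • θ
    ∂(quantiled L β δq R ϱ)

/-! ### The Fokker-Planck equation -/

/-- The isotropic diffusion matrix `D(v) = ‖v‖ Id`. -/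
def diffusion {d : ℕ} (v : E d) : Matrix (Fin d) (Fin d) ℝ := ‖v‖ • 1

/-- The second partial derivative `∂_{kk} φ`. -/
def partialSq {d : ℕ} (φ : E d → ℝ) (k : Fin d) (θ : E d) : ℝ :=
  fderiv ℝ (fun y => fderiv ℝ φ y (EuclideanSpace.single k 1)) θ (EuclideanSpace.single k 1)

/-- `ρ` is a weak solution on `[0,T]`, with initial datum `ρ₀`, of
`∂_t ρ_t = λ div((θ - m_t) ρ_t) + σ²/2 ∑_k ∂_{kk}(D(θ - m_t)_{kk}² ρ_t)`,
tested against functions in `𝒞_c^∞(ℝ^d)`. -/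
structure IsWeakSolution {d : ℕ} (lam σ T : ℝ) (m : ℝ → E d) (ρ₀ : Measure (E d))
    (ρ : ℝ → Measure (E d)) : Prop where
  initial : ρ 0 = ρ₀
  evolution : ∀ φ : E d → ℝ, ContDiff ℝ ∞ φ → HasCompactSupport φ → ∀ t ∈ Ioo 0 T,
    HasDerivAt (fun s => ∫ θ, φ θ ∂(ρ s))
      (-lam * (∫ θ, inner ℝ (θ - m t) (gradient φ θ) ∂(ρ t))
        + σ ^ 2 / 2 * ∑ k, ∫ θ, (diffusion (θ - m t) k k) ^ 2 * partialSq φ k θ ∂(ρ t)) t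

/-! ### Assumptions on the objective functions -/

/-- The set `Θ` of global minimizers of `L`. -/
def minimizers {d : ℕ} (L : E d → ℝ) : Set (E d) := {θ | ∀ θ', L θ ≤ L θ'}

/-- The closed neighborhood `𝒩_r(S)`. -/
def nbhd {d : ℕ} (r : ℝ) (S : Set (E d)) : Set (E d) := {θ | Metric.infDist θ S ≤ r}

/-- `θg` is the unique minimizer of `G` over the set of global minimizers of `L`. -/
def UniqueGoodMinimizer {d : ℕ} (L G : E d → ℝ) (θg : E d) : Prop :=
  (θg ∈ minimizers L ∧ ∀ θ ∈ minimizers L, G θg ≤ G θ) ∧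
    ∀ θ₁, (θ₁ ∈ minimizers L ∧ ∀ θ ∈ minimizers L, G θ₁ ≤ G θ) → θ₁ = θg

/-- Local Hölder-type upper bound at `θg`. -/
def HolderAt {d : ℕ} (f : E d → ℝ) (θg : E d) : Prop :=
  ∃ h RH H : ℝ, 0 < h ∧ 0 < RH ∧
    ∀ θ ∈ Metric.closedBall θg RH, f θ - f θg ≤ H * ‖θ - θg‖ ^ h

/-- Inverse continuity of `L`. -/
def InverseContinuityL {d : ℕ} (L : E d → ℝ) (θg : E d) : Prop :=
  ∃ Linf RL ηL νL : ℝ, 0 < Linf ∧ 0 < RL ∧ 0 < ηL ∧ 0 < νL ∧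
    (∀ θ ∈ nbhd RL (minimizers L),
      Metric.infDist θ (minimizers L) ≤ 1 / ηL * (L θ - L θg) ^ νL) ∧
    ∀ θ, θ ∉ nbhd RL (minimizers L) → Linf < L θ - L θg

/-- Inverse continuity of `G` near `Θ`, with radius `RG`. The clause `G θt ≤ G θ` makes the
power of `G θ - G θt` meaningful. -/
def InverseContinuityG {d : ℕ} (L G : E d → ℝ) (θg : E d) (RG : ℝ) : Prop :=
  0 < RG ∧ ∃ Ginf ηG νG : ℝ, 0 < Ginf ∧ 0 < ηG ∧ 0 < νG ∧
    ∀ rG : ℝ, 0 < rG → rG ≤ RG → ∃ θt ∈ Metric.closedBall θg rG,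
      (∀ θ ∈ Metric.closedBall θg rG,
        G θt ≤ G θ ∧ ‖θ - θt‖ ≤ 1 / ηG * (G θ - G θt) ^ νG) ∧
      ∀ θ ∈ nbhd rG (minimizers L) \ Metric.closedBall θg rG, Ginf < G θ - G θt

/-- Growth of `G` in the farfield near `Θ`, with the radius `RG` of the inverse continuity and farfield
radius `RGK`. -/
def GrowthG {d : ℕ} (L G : E d → ℝ) (θg : E d) (RG RGK : ℝ) : Prop :=
  0 < RGK ∧ ∃ kG KG : ℝ, 0 < kG ∧ 0 < KG ∧
    ∀ θ ∈ (Metric.closedBall θg RGK)ᶜ ∩ nbhd RG (minimizers L),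
      KG * ‖θ - θg‖ ^ kG ≤ G θ - G θg

/-- The time horizon `T* = log(W_2²(ρ₀, δ_{θg}) / (2ε)) / ((1-ϑ)(2λ - dσ²))`. -/
def horizon {d : ℕ} (θg : E d) (ρ₀ : Measure (E d)) (ε ϑ lam σ : ℝ) : ℝ :=
  1 / ((1 - ϑ) * (2 * lam - d * σ ^ 2)) * Real.log (W2sq ρ₀ (Measure.dirac θg) / (2 * ε))

end

end CB2O

/-!
Let `V t = ∫ ‖θ - θg‖² dρb_t`, which is `W₂²(ρb_t, δ_{θg})` because the only coupling with a Dirac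
mass is the product (`W2sq_dirac`). Testing the equation with `‖θ - θg‖²` gives
`V' = -(2λ - dσ²) V` up to an error controlled by the distance of the consensus point to `θg`; as
long as `V ≥ 2ε` and that distance is at most a small multiple of `√ε`, the error is at most
`(ϑ / 2) (2λ - dσ²) V` (`abs_integral_radialGenerator_add_le`). Grönwall's inequality from above and
below then gives the decay and the two bounds on the first time at which `V = 2ε`
(`exists_hitting_time`). The test function `‖θ - θg‖²` is not compactly supported; it is reached
through truncations whose derivatives converge uniformly in time, thanks to the fourth moments
(`IsWeakSolution.hasDerivAt_secondMoment`).

It remains to keep the consensus point near `θg` during the whole time interval. It always lies in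
the ball of radius `R`, so the drift is bounded, and the smooth bump
`exp (-1 / (r² - ‖θ - θg‖²))` is a subsolution up to a zeroth-order term
(`exists_bump_generator_bound`): hence `ρb_t` charges every small ball around `θg` with a mass
bounded below uniformly in time and in the weights (`exists_mass_lower_bound`). For `β` below this
mass times `wb`, the averaged quantile is within `δq / 2` of `min L`, so that the quantiled sublevel
set contains a small ball around `θg` and is contained in a small neighborhood of the minimizers
of `L`. There `G` exceeds its values near `θg` by a fixed gap, and the Laplace principle
(`norm_consensus_sub_le`) makes the contribution of the points far from `θg` exponentially small
in `α`. The denominator in the Laplace principle carries a factor `wb`, which is compensated by the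
logarithmic term in the threshold for `α` (`exp_div_weight_le`).
-/

namespace CB2O

/-! ### Couplings: the distance to a Dirac mass, and continuity of curves in `𝒫₄` -/

/-- The only coupling with a Dirac mass is the product one. -/
theorem W2sq_dirac {d : ℕ} (μ : Measure (E d)) [IsProbabilityMeasure μ] (θ₀ : E d) :
    W2sq μ (Measure.dirac θ₀) = ∫ θ, ‖θ - θ₀‖ ^ 2 ∂μ := by
  have hmeas : Measurable fun θ : E d => ‖θ - θ₀‖ₑ ^ 2 := by fun_prop
  have hinf : (⨅ π ∈ couplings μ (Measure.dirac θ₀), ∫⁻ z, ‖z.1 - z.2‖ₑ ^ 2 ∂π)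
      = ∫⁻ θ, ‖θ - θ₀‖ₑ ^ 2 ∂μ := by
    apply le_antisymm
    · have hm : Measurable fun θ : E d => (θ, θ₀) := by fun_prop
      refine (iInf₂_le (μ.map fun θ => (θ, θ₀) : Measure (E d × E d)) ?_).trans ?_
      · constructor
        · rw [Measure.map_map measurable_fst hm]
          exact Measure.map_id
        · rw [Measure.map_map measurable_snd hm]
          exact (Measure.map_const μ θ₀).trans (by simp)
      · rw [lintegral_map (by fun_prop) hm]
    · refine le_iInf₂ fun π hπ => ?_
      have hae : ∀ᵐ z ∂π, z.2 = θ₀ := by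
        have : ∀ᵐ y ∂(π.map Prod.snd), y = θ₀ := by
          rw [hπ.2, ae_dirac_eq]; rfl
        exact ae_of_ae_map measurable_snd.aemeasurable this
      rw [← hπ.1, lintegral_map hmeas measurable_fst]
      refine (lintegral_congr_ae ?_).le
      filter_upwards [hae] with z hz
      rw [hz]
  rw [W2sq, wasserstein]
  push_cast
  rw [hinf, ← ENNReal.toReal_rpow, ← Real.sqrt_eq_rpow, Real.sq_sqrt ENNReal.toReal_nonneg,
    integral_eq_lintegral_of_nonneg_ae (ae_of_all _ fun _ => by positivity)
      (by fun_prop : Measurable _).aestronglyMeasurable]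
  congr 1
  refine lintegral_congr fun θ => ?_
  rw [ENNReal.ofReal_pow (norm_nonneg _), ofReal_norm]

/-- A Wasserstein-4 bound provides a coupling whose cost is below the bound. -/
theorem exists_coupling_of_wasserstein_lt {d : ℕ} {μ ν : Measure (E d)} {η : ℝ≥0∞}
    (h : wasserstein 4 μ ν < η) :
    ∃ π ∈ couplings μ ν, ∫⁻ z, ‖z.1 - z.2‖ₑ ^ 4 ∂π < η ^ 4 := by
  have h4 : (⨅ π ∈ couplings μ ν, ∫⁻ z, ‖z.1 - z.2‖ₑ ^ 4 ∂π) < η ^ 4 := by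
    rw [wasserstein] at h
    have := (ENNReal.rpow_lt_rpow_iff (z := 4) (by norm_num)).2 h
    rw [← ENNReal.rpow_mul] at this
    norm_num at this
    exact_mod_cast this
  simpa only [iInf_lt_iff, exists_prop] using h4

theorem isProbabilityMeasure_of_mem_couplings {d : ℕ} {μ ν : Measure (E d)}
    [IsProbabilityMeasure μ] {π : Measure (E d × E d)} (hπ : π ∈ couplings μ ν) :
    IsProbabilityMeasure π := by
  constructor
  have := measure_univ (μ := μ)
  rw [← hπ.1, Measure.map_apply measurable_fst MeasurableSet.univ] at this
  simpa using this

theorem ContinuousInP.continuousOn_integral {d : ℕ} {T : ℝ} {ρ : ℝ → Measure (E d)}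
    (hρ : ContinuousInP 4 T ρ) {φ : E d → ℝ} {K : NNReal} (hφ : LipschitzWith K φ)
    (hc : HasCompactSupport φ) : ContinuousOn (fun t => ∫ θ, φ θ ∂(ρ t)) (Icc 0 T) := by
  intro t ht
  rw [ContinuousWithinAt, Metric.tendsto_nhds]
  intro ε hε
  obtain ⟨η, hη, hηε⟩ : ∃ η : ℝ, 0 < η ∧ K * (2 * η) < ε := by
    refine ⟨ε / (4 * (K + 1)), by positivity, ?_⟩
    have : (K : ℝ) < K + 1 := by linarith
    calc (K : ℝ) * (2 * (ε / (4 * (K + 1)))) = ε / 2 * (K / (K + 1)) := by field_simp; ring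
      _ ≤ ε / 2 * 1 := by gcongr; rw [div_le_one (by positivity)]; exact this.le
      _ < ε := by linarith
  have hev := (hρ.2 t ht).eventually (gt_mem_nhds (ENNReal.ofReal_pos.2 hη))
  filter_upwards [hev, self_mem_nhdsWithin] with s hs hsT
  obtain ⟨π, hπ, hcost⟩ := exists_coupling_of_wasserstein_lt hs
  have := (hρ.1 s hsT).1
  have := (hρ.1 t ht).1
  have := isProbabilityMeasure_of_mem_couplings hπ
  have hcont := hφ.continuous
  have hint1 : Integrable (fun z : E d × E d => φ z.1) π := by
    have : Integrable φ (π.map Prod.fst) := by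
      rw [hπ.1]; exact hcont.integrable_of_hasCompactSupport hc
    exact this.comp_measurable measurable_fst
  have hint2 : Integrable (fun z : E d × E d => φ z.2) π := by
    have : Integrable φ (π.map Prod.snd) := by
      rw [hπ.2]; exact hcont.integrable_of_hasCompactSupport hc
    exact this.comp_measurable measurable_snd
  have hcost' : ∫⁻ z, ‖z.1 - z.2‖ₑ ^ 4 ∂π ≠ ⊤ := (hcost.trans (by simp)).ne
  have hq : Integrable (fun z : E d × E d => ‖z.1 - z.2‖ ^ 4) π := by
    refine ⟨by fun_prop, ?_⟩
    simpa [HasFiniteIntegral, lt_top_iff_ne_top, enorm_pow] using hcost'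
  have hqval : ∫ z, ‖z.1 - z.2‖ ^ 4 ∂π ≤ η ^ 4 := by
    rw [integral_eq_lintegral_of_nonneg_ae (ae_of_all _ fun _ => by positivity)
      hq.aestronglyMeasurable]
    refine ENNReal.toReal_le_of_le_ofReal (by positivity) ?_
    rw [ENNReal.ofReal_pow hη.le]
    refine le_trans (le_of_eq ?_) hcost.le
    refine lintegral_congr fun z => ?_
    rw [ENNReal.ofReal_pow (norm_nonneg _), ofReal_norm]
  have e1 : ∫ θ, φ θ ∂(ρ s) = ∫ z, φ z.1 ∂π := by
    rw [← hπ.1, integral_map measurable_fst.aemeasurable hcont.aestronglyMeasurable]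
  have e2 : ∫ θ, φ θ ∂(ρ t) = ∫ z, φ z.2 ∂π := by
    rw [← hπ.2, integral_map measurable_snd.aemeasurable hcont.aestronglyMeasurable]
  rw [e1, e2, Real.dist_eq, ← integral_sub hint1 hint2]
  refine lt_of_le_of_lt ?_ hηε
  -- `r ≤ η + r⁴ / η³` turns the quartic cost into a bound on the linear one.
  have hpt : ∀ z : E d × E d, ‖φ z.1 - φ z.2‖ ≤ K * (η + ‖z.1 - z.2‖ ^ 4 / η ^ 3) := by
    intro z
    have h1 : ‖φ z.1 - φ z.2‖ ≤ K * ‖z.1 - z.2‖ := hφ.norm_sub_le _ _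
    refine h1.trans ?_
    gcongr
    rcases le_total ‖z.1 - z.2‖ η with h | h
    · have : 0 ≤ ‖z.1 - z.2‖ ^ 4 / η ^ 3 := by positivity
      linarith
    · have : ‖z.1 - z.2‖ ≤ ‖z.1 - z.2‖ ^ 4 / η ^ 3 := by
        rw [le_div_iff₀ (by positivity)]
        calc ‖z.1 - z.2‖ * η ^ 3 ≤ ‖z.1 - z.2‖ * ‖z.1 - z.2‖ ^ 3 := by gcongr
          _ = _ := by ring
      linarith
  have hbound : Integrable (fun z : E d × E d => K * (η + ‖z.1 - z.2‖ ^ 4 / η ^ 3)) π :=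
    ((integrable_const _).add (hq.div_const _)).const_mul _
  calc |∫ z, (φ z.1 - φ z.2) ∂π| ≤ ∫ z, K * (η + ‖z.1 - z.2‖ ^ 4 / η ^ 3) ∂π :=
        norm_integral_le_of_norm_le hbound (ae_of_all _ hpt)
    _ = K * (η + (∫ z, ‖z.1 - z.2‖ ^ 4 ∂π) / η ^ 3) := by
        rw [integral_const_mul, integral_add (integrable_const _) (hq.div_const _),
          integral_div]
        simp
    _ ≤ K * (η + η ^ 4 / η ^ 3) := by gcongr
    _ = K * (2 * η) := by field_simp; ring

theorem InP.lintegral_lt_top {d : ℕ} {μ : Measure (E d)} (h : InP 4 μ) (θ₀ : E d) :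
    ∫⁻ θ, ‖θ - θ₀‖ₑ ^ 4 ∂μ < ⊤ := by
  have := h.1
  have hm : MemLp (fun θ : E d => θ - θ₀) 4 μ := by
    refine MemLp.sub ?_ (memLp_const _)
    refine (integrable_norm_rpow_iff (by fun_prop) (by norm_num) (by norm_num)).1 ?_
    refine h.2.congr (ae_of_all _ fun θ => ?_)
    beta_reduce
    rw [ENNReal.toReal_ofNat]
    exact_mod_cast (Real.rpow_natCast _ 4).symm
  have := hm.integrable_norm_pow (p := 4) (by norm_num)
  have h2 := this.2
  simpa [HasFiniteIntegral, enorm_pow] using h2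

/-- Fourth moments are bounded along a curve in `𝒞([0,T], 𝒫₄)`: they are locally bounded
because `(a + b)⁴ ≤ 16 (a⁴ + b⁴)`, and `[0,T]` is compact. -/
theorem ContinuousInP.exists_moment_bound {d : ℕ} {T : ℝ} {ρ : ℝ → Measure (E d)}
    (hρ : ContinuousInP 4 T ρ) (θ₀ : E d) :
    ∃ M : ℝ, ∀ t ∈ Icc 0 T, Integrable (fun θ => ‖θ - θ₀‖ ^ 4) (ρ t) ∧
      ∫ θ, ‖θ - θ₀‖ ^ 4 ∂(ρ t) ≤ M := by
  have key : ∃ M : ℝ≥0∞, M < ⊤ ∧ ∀ t ∈ Icc 0 T, t ∈ Icc 0 T →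
      ∫⁻ θ, ‖θ - θ₀‖ₑ ^ 4 ∂(ρ t) ≤ M := by
    refine isCompact_Icc.induction_on (p := fun S => ∃ M : ℝ≥0∞, M < ⊤ ∧ ∀ t ∈ S, t ∈ Icc 0 T →
      ∫⁻ θ, ‖θ - θ₀‖ₑ ^ 4 ∂(ρ t) ≤ M) ⟨0, by simp, by simp⟩ ?_ ?_ ?_
    · rintro S S' hS ⟨M, hM, h⟩
      exact ⟨M, hM, fun t ht => h t (hS ht)⟩
    · rintro S S' ⟨M, hM, h⟩ ⟨M', hM', h'⟩
      refine ⟨max M M', max_lt hM hM', fun t ht htT => ?_⟩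
      rcases ht with ht | ht
      · exact (h t ht htT).trans (le_max_left _ _)
      · exact (h' t ht htT).trans (le_max_right _ _)
    · intro t ht
      refine ⟨{s | wasserstein 4 (ρ s) (ρ t) < 1},
        (hρ.2 t ht).eventually (gt_mem_nhds one_pos),
        16 * (1 + ∫⁻ θ, ‖θ - θ₀‖ₑ ^ 4 ∂(ρ t)), ?_, ?_⟩
      · have := (hρ.1 t ht).lintegral_lt_top θ₀
        exact ENNReal.mul_lt_top (by simp) (ENNReal.add_lt_top.2 ⟨by simp, this⟩)
      · intro s hs _
        obtain ⟨π, hπ, hcost⟩ := exists_coupling_of_wasserstein_lt hs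
        have hmeas : Measurable fun θ : E d => ‖θ - θ₀‖ₑ ^ 4 := by fun_prop
        nth_rewrite 1 [← hπ.1]
        rw [← hπ.2, lintegral_map hmeas measurable_fst, lintegral_map hmeas measurable_snd]
        calc ∫⁻ z, ‖z.1 - θ₀‖ₑ ^ 4 ∂π
            ≤ ∫⁻ z, 16 * (‖z.1 - z.2‖ₑ ^ 4 + ‖z.2 - θ₀‖ₑ ^ 4) ∂π := by
              refine lintegral_mono fun z => ?_
              have h1 : ‖z.1 - θ₀‖ₑ ≤ ‖z.1 - z.2‖ₑ + ‖z.2 - θ₀‖ₑ := by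
                have := enorm_add_le (z.1 - z.2) (z.2 - θ₀)
                rwa [sub_add_sub_cancel] at this
              have h2 : ‖z.1 - θ₀‖ₑ ≤ 2 * max ‖z.1 - z.2‖ₑ ‖z.2 - θ₀‖ₑ := by
                rw [two_mul]
                exact h1.trans (add_le_add (le_max_left _ _) (le_max_right _ _))
              calc ‖z.1 - θ₀‖ₑ ^ 4 ≤ (2 * max ‖z.1 - z.2‖ₑ ‖z.2 - θ₀‖ₑ) ^ 4 := by gcongr
                _ = 16 * (max ‖z.1 - z.2‖ₑ ‖z.2 - θ₀‖ₑ) ^ 4 := by rw [mul_pow]; norm_num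
                _ ≤ _ := by
                  gcongr
                  rcases max_cases ‖z.1 - z.2‖ₑ ‖z.2 - θ₀‖ₑ with h | h <;> rw [h.1] <;> simp
          _ = 16 * (∫⁻ z, ‖z.1 - z.2‖ₑ ^ 4 ∂π + ∫⁻ z, ‖z.2 - θ₀‖ₑ ^ 4 ∂π) := by
              rw [lintegral_const_mul _ (by fun_prop), lintegral_add_left (by fun_prop)]
          _ ≤ _ := by
              gcongr
              simpa using hcost.le
  obtain ⟨M, hM, h⟩ := key
  refine ⟨M.toReal, fun t ht => ?_⟩
  have hfin := (h t ht ht).trans_lt hM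
  have hint : Integrable (fun θ => ‖θ - θ₀‖ ^ 4) (ρ t) := by
    refine ⟨by fun_prop, ?_⟩
    simpa [HasFiniteIntegral, enorm_pow] using hfin
  refine ⟨hint, ?_⟩
  rw [integral_eq_lintegral_of_nonneg_ae (ae_of_all _ fun _ => by positivity)
      hint.aestronglyMeasurable]
  refine ENNReal.toReal_mono hM.ne (le_trans (le_of_eq ?_) (h t ht ht))
  refine lintegral_congr fun z => ?_
  rw [ENNReal.ofReal_pow (norm_nonneg _), ofReal_norm]

/-! ### Radial test functions -/

/-- The generator of the equation with consensus point `m`, applied to the radial function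
`θ ↦ F(‖θ - θ₀‖²)`, expressed through the first two derivatives `F₁`, `F₂` of the profile `F`. -/
noncomputable def radialGenerator {d : ℕ} (lam σ : ℝ) (θ₀ m : E d) (F₁ F₂ : ℝ → ℝ) (θ : E d) : ℝ :=
  -lam * (2 * F₁ (‖θ - θ₀‖ ^ 2) * inner ℝ (θ - m) (θ - θ₀))
    + σ ^ 2 / 2 * (‖θ - m‖ ^ 2 *
      (4 * F₂ (‖θ - θ₀‖ ^ 2) * ‖θ - θ₀‖ ^ 2 + 2 * d * F₁ (‖θ - θ₀‖ ^ 2)))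

section Radial

variable {d : ℕ} {F F₁ F₂ : ℝ → ℝ} (θ₀ : E d)

theorem hasFDerivAt_radial (hF : ∀ s, HasDerivAt F (F₁ s) s) (θ : E d) :
    HasFDerivAt (fun y => F (‖y - θ₀‖ ^ 2))
      ((2 * F₁ (‖θ - θ₀‖ ^ 2)) • innerSL ℝ (θ - θ₀)) θ := by
  have h1 : HasFDerivAt (fun y : E d => ‖y - θ₀‖ ^ 2) (2 • (innerSL ℝ (θ - θ₀))) θ := by
    simpa using ((hasFDerivAt_id θ).sub_const θ₀).norm_sq
  refine ((hF (‖θ - θ₀‖ ^ 2)).comp_hasFDerivAt θ h1).congr_fderiv ?_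
  ext v
  simp
  ring

theorem gradient_radial (hF : ∀ s, HasDerivAt F (F₁ s) s) (θ : E d) :
    gradient (fun y => F (‖y - θ₀‖ ^ 2)) θ = (2 * F₁ (‖θ - θ₀‖ ^ 2)) • (θ - θ₀) := by
  apply HasGradientAt.gradient
  rw [hasGradientAt_iff_hasFDerivAt]
  refine (hasFDerivAt_radial θ₀ hF θ).congr_fderiv ?_
  ext v
  simp

theorem partialSq_radial (hF : ∀ s, HasDerivAt F (F₁ s) s) (hF₁ : ∀ s, HasDerivAt F₁ (F₂ s) s)
    (k : Fin d) (θ : E d) :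
    partialSq (fun y => F (‖y - θ₀‖ ^ 2)) k θ =
      4 * F₂ (‖θ - θ₀‖ ^ 2) * (θ - θ₀) k ^ 2 + 2 * F₁ (‖θ - θ₀‖ ^ 2) := by
  have h1 : (fun y => fderiv ℝ (fun y => F (‖y - θ₀‖ ^ 2)) y (EuclideanSpace.single k 1))
      = fun y => 2 * F₁ (‖y - θ₀‖ ^ 2) * (y - θ₀) k := by
    funext y
    rw [(hasFDerivAt_radial θ₀ hF y).fderiv]
    simp [EuclideanSpace.inner_single_right]
  have h2 : HasFDerivAt (fun y : E d => (y - θ₀) k) (EuclideanSpace.proj k : E d →L[ℝ] ℝ) θ :=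
    (EuclideanSpace.proj k : E d →L[ℝ] ℝ).hasFDerivAt.comp θ ((hasFDerivAt_id θ).sub_const θ₀)
  rw [partialSq, h1, (((hasFDerivAt_radial θ₀ hF₁ θ).const_mul 2).fun_mul h2).fderiv]
  simp [EuclideanSpace.inner_single_right]
  ring

theorem hasCompactSupport_radial {G : E d → ℝ} {c : ℝ} (hG : ∀ θ, c ≤ ‖θ - θ₀‖ → G θ = 0) :
    HasCompactSupport G := by
  refine HasCompactSupport.intro (isCompact_closedBall θ₀ c) fun θ hθ => hG θ ?_
  rw [Metric.mem_closedBall, dist_eq_norm, not_le] at hθ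
  exact hθ.le

variable {θ₀}

theorem continuous_radialGenerator {lam σ : ℝ} {m : E d} (h₁ : Continuous F₁)
    (h₂ : Continuous F₂) : Continuous (radialGenerator lam σ θ₀ m F₁ F₂) := by
  unfold radialGenerator
  fun_prop

/-- The weak formulation for a smooth radial test function whose profile vanishes beyond `c²`. -/
theorem IsWeakSolution.hasDerivAt_radial {lam σ T : ℝ} {m : ℝ → E d} {ρ₀ : Measure (E d)}
    {ρ : ℝ → Measure (E d)} (hρ : IsWeakSolution lam σ T m ρ₀ ρ) {t : ℝ} (ht : t ∈ Ioo 0 T)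
    [IsFiniteMeasure (ρ t)] (hFc : ContDiff ℝ ∞ F)
    (hF : ∀ s, HasDerivAt F (F₁ s) s) (hF₁ : ∀ s, HasDerivAt F₁ (F₂ s) s)
    (hc₂ : Continuous F₂) {c : ℝ} (hc : 0 ≤ c)
    (h0 : ∀ s, c ^ 2 ≤ s → F s = 0 ∧ F₁ s = 0 ∧ F₂ s = 0) :
    HasDerivAt (fun s => ∫ θ, F (‖θ - θ₀‖ ^ 2) ∂(ρ s))
      (∫ θ, radialGenerator lam σ θ₀ (m t) F₁ F₂ θ ∂(ρ t)) t := by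
  have hc₁ : Continuous F₁ :=
    continuous_iff_continuousAt.2 fun s => (hF₁ s).continuousAt
  have hsq : ∀ θ : E d, c ≤ ‖θ - θ₀‖ → c ^ 2 ≤ ‖θ - θ₀‖ ^ 2 := fun θ h => by gcongr
  have hsmooth : ContDiff ℝ ∞ fun θ : E d => F (‖θ - θ₀‖ ^ 2) :=
    hFc.comp ((contDiff_id.sub contDiff_const).norm_sq ℝ)
  have key := hρ.evolution _ hsmooth
    (hasCompactSupport_radial θ₀ (c := c) fun θ h => (h0 _ (hsq θ h)).1) t ht
  convert key using 1
  have hi1 : Integrable (fun θ => 2 * F₁ (‖θ - θ₀‖ ^ 2) * inner ℝ (θ - m t) (θ - θ₀)) (ρ t) := by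
    refine Continuous.integrable_of_hasCompactSupport (by fun_prop)
      (hasCompactSupport_radial θ₀ (c := c) fun θ h => ?_)
    simp [(h0 _ (hsq θ h)).2.1]
  have hi2 : ∀ k ∈ (Finset.univ : Finset (Fin d)), Integrable (fun θ => ‖θ - m t‖ ^ 2 *
      (4 * F₂ (‖θ - θ₀‖ ^ 2) * (θ - θ₀) k ^ 2 + 2 * F₁ (‖θ - θ₀‖ ^ 2))) (ρ t) := by
    intro k _
    refine Continuous.integrable_of_hasCompactSupport (by fun_prop)
      (hasCompactSupport_radial θ₀ (c := c) fun θ h => ?_)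
    simp [(h0 _ (hsq θ h)).2.1, (h0 _ (hsq θ h)).2.2]
  have e1 : ∀ θ, inner ℝ (θ - m t) (gradient (fun y => F (‖y - θ₀‖ ^ 2)) θ)
      = 2 * F₁ (‖θ - θ₀‖ ^ 2) * inner ℝ (θ - m t) (θ - θ₀) := fun θ => by
    rw [gradient_radial θ₀ hF, inner_smul_right]
  have e2 : ∀ k θ, (diffusion (θ - m t) k k) ^ 2 * partialSq (fun y => F (‖y - θ₀‖ ^ 2)) k θ
      = ‖θ - m t‖ ^ 2 *
      (4 * F₂ (‖θ - θ₀‖ ^ 2) * (θ - θ₀) k ^ 2 + 2 * F₁ (‖θ - θ₀‖ ^ 2)) := fun k θ => by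
    rw [partialSq_radial θ₀ hF hF₁]
    simp [diffusion]
  simp_rw [e1, e2]
  rw [← integral_finsetSum _ hi2, ← integral_const_mul, ← integral_const_mul,
    ← integral_add (hi1.const_mul _) ((integrable_finsetSum _ hi2).const_mul _)]
  refine integral_congr_ae (ae_of_all _ fun θ => ?_)
  simp only [radialGenerator]
  rw [← Finset.mul_sum, Finset.sum_add_distrib, ← Finset.mul_sum, EuclideanSpace.real_norm_sq_eq (θ - θ₀)]
  simp only [Finset.sum_const, Finset.card_univ, Fintype.card_fin, nsmul_eq_mul]
  ring

end Radial

/-- Continuity in time of integrals of smooth radial test functions. -/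
theorem ContinuousInP.continuousOn_integral_radial {d : ℕ} {T : ℝ} {ρ : ℝ → Measure (E d)}
    (hρ : ContinuousInP 4 T ρ) (θ₀ : E d) {F : ℝ → ℝ} (hFc : ContDiff ℝ ∞ F) {c : ℝ} (hc : 0 ≤ c)
    (h0 : ∀ s, c ^ 2 ≤ s → F s = 0) :
    ContinuousOn (fun t => ∫ θ, F (‖θ - θ₀‖ ^ 2) ∂(ρ t)) (Icc 0 T) := by
  have hsmooth : ContDiff ℝ ∞ fun θ : E d => F (‖θ - θ₀‖ ^ 2) :=
    hFc.comp ((contDiff_id.sub contDiff_const).norm_sq ℝ)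
  have hcs : HasCompactSupport fun θ : E d => F (‖θ - θ₀‖ ^ 2) :=
    hasCompactSupport_radial θ₀ (c := c) fun θ h => h0 _ (by gcongr)
  obtain ⟨K, hK⟩ := ContDiff.lipschitzWith_of_hasCompactSupport hcs hsmooth (by simp)
  exact hρ.continuousOn_integral hK hcs

/-! ### Mass near the target point -/

section Bump

theorem expNegInvGlue_le_one (x : ℝ) : expNegInvGlue x ≤ 1 := by
  unfold expNegInvGlue
  split_ifs with h
  · exact zero_le_one
  · rw [Real.exp_le_one_iff]
    push Not at h
    simpa using h.le

theorem hasDerivAt_expNegInvGlue_sub (a s : ℝ) :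
    HasDerivAt (fun s => expNegInvGlue (a - s)) (-((a - s)⁻¹ ^ 2 * expNegInvGlue (a - s))) s := by
  have h := expNegInvGlue.hasDerivAt_polynomial_eval_inv_mul 1 (a - s)
  have h2 : HasDerivAt (fun s => Polynomial.eval (a - s)⁻¹ 1 * expNegInvGlue (a - s)) _ s :=
    h.comp s ((hasDerivAt_id s).const_sub a)
  simp only [Polynomial.eval_one, one_mul] at h2
  exact h2.congr_deriv (by simp)

theorem hasDerivAt_expNegInvGlue_sub_deriv (a s : ℝ) :
    HasDerivAt (fun s => -((a - s)⁻¹ ^ 2 * expNegInvGlue (a - s)))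
      (((a - s)⁻¹ ^ 4 - 2 * (a - s)⁻¹ ^ 3) * expNegInvGlue (a - s)) s := by
  have h := expNegInvGlue.hasDerivAt_polynomial_eval_inv_mul (Polynomial.X ^ 2) (a - s)
  have h2 : HasDerivAt (fun s => -(Polynomial.eval (a - s)⁻¹ (Polynomial.X ^ 2)
      * expNegInvGlue (a - s))) _ s := (h.comp s ((hasDerivAt_id s).const_sub a)).neg
  simp only [Polynomial.eval_pow, Polynomial.eval_X] at h2
  refine h2.congr_deriv ?_
  generalize (a - s)⁻¹ = y
  generalize expNegInvGlue (a - s) = g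
  simp [-mul_eq_mul_right_iff]
  ring

theorem continuous_expNegInvGlue_sub_deriv_two (a : ℝ) :
    Continuous fun s : ℝ => ((a - s)⁻¹ ^ 4 - 2 * (a - s)⁻¹ ^ 3) * expNegInvGlue (a - s) := by
  have h : Continuous fun s : ℝ => Polynomial.eval (a - s)⁻¹
      (Polynomial.X ^ 4 - Polynomial.C 2 * Polynomial.X ^ 3) * expNegInvGlue (a - s) :=
    (expNegInvGlue.continuous_polynomial_eval_inv_mul _).comp (continuous_const.sub continuous_id)
  simpa only [Polynomial.eval_sub, Polynomial.eval_mul, Polynomial.eval_C, Polynomial.eval_pow,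
    Polynomial.eval_X] using h

/-- With `y = (r² - s)⁻¹`, this is the generator of `exp (-y)` divided by `exp (-y)`, bounded below.
Near the boundary of the ball (`y` large) the second-order term is a square in `w y²` that
dominates the drift even where the diffusion `w` degenerates; elsewhere all terms are bounded. -/
theorem exists_generator_quotient_bound (D lam σ r W : ℝ) (hD : 0 ≤ D) (hlam : 0 < lam)
    (hσ : 0 < σ) (hr : 0 < r) (hW : 0 ≤ W) :
    ∃ p : ℝ, 0 ≤ p ∧ ∀ y s w i : ℝ, 0 < y → 0 ≤ s → s = r ^ 2 - y⁻¹ → 0 ≤ w → w ≤ W →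
      |i| ≤ w * r →
      -p ≤ 2 * lam * y ^ 2 * i
        + σ ^ 2 / 2 * (w ^ 2 * (4 * (y ^ 4 - 2 * y ^ 3) * s - 2 * D * y ^ 2)) := by
  set Y : ℝ := 4 + 4 * (D + 1) / r ^ 2 with hY
  have hYpos : 0 < Y := by positivity
  refine ⟨4 * lam ^ 2 / σ ^ 2 + (2 * lam * Y ^ 2 * (W * r)
    + σ ^ 2 * (W ^ 2 * (4 * Y ^ 3 * r ^ 2 + D * Y ^ 2))), by positivity, ?_⟩
  intro y s w i hy hs hsy hw hwW hi
  have hi' : -(w * r) ≤ i := (abs_le.1 hi).1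
  have hdrift : -(2 * lam * y ^ 2 * (w * r)) ≤ 2 * lam * y ^ 2 * i := by
    have := mul_le_mul_of_nonneg_left hi' (by positivity : 0 ≤ 2 * lam * y ^ 2)
    linarith
  rcases le_total Y y with h | h
  · have hy4 : 4 ≤ y := by
      have : 0 ≤ 4 * (D + 1) / r ^ 2 := by positivity
      linarith
    have hyD : 4 * (D + 1) ≤ y * r ^ 2 := by
      have : 4 * (D + 1) / r ^ 2 ≤ y := by linarith
      rwa [div_le_iff₀ (by positivity)] at this
    have hyinv : y⁻¹ ≤ r ^ 2 / 2 := by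
      rw [inv_le_iff_one_le_mul₀ hy]
      nlinarith
    have hs2 : r ^ 2 / 2 ≤ s := by linarith
    have h1 : y ^ 4 * s ≤ 2 * (y ^ 4 - 2 * y ^ 3) * s := by
      have : y ^ 4 ≤ 2 * (y ^ 4 - 2 * y ^ 3) := by
        have : 0 ≤ y ^ 3 * (y - 4) := mul_nonneg (by positivity) (by linarith)
        nlinarith
      exact mul_le_mul_of_nonneg_right this hs
    have h2 : y ^ 4 * (r ^ 2 / 2) ≤ y ^ 4 * s := by gcongr
    have h3 : D * y ^ 2 ≤ y ^ 4 * r ^ 2 / 4 := by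
      have : D ≤ y * (y * r ^ 2) / 4 := by nlinarith
      calc D * y ^ 2 ≤ y * (y * r ^ 2) / 4 * y ^ 2 := by gcongr
        _ = _ := by ring
    have h4 : y ^ 4 * r ^ 2 / 4 ≤ 2 * (y ^ 4 - 2 * y ^ 3) * s - D * y ^ 2 := by linarith
    have h5 : σ ^ 2 * (w ^ 2 * (y ^ 4 * r ^ 2 / 4))
        ≤ σ ^ 2 * (w ^ 2 * (2 * (y ^ 4 - 2 * y ^ 3) * s - D * y ^ 2)) := by gcongr
    have hsquare : -(4 * lam ^ 2 / σ ^ 2) ≤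
        σ ^ 2 * (w ^ 2 * (y ^ 4 * r ^ 2 / 4)) - 2 * lam * y ^ 2 * (w * r) := by
      have : 0 ≤ (σ * (w * y ^ 2 * r) / 2 - 2 * lam / σ) ^ 2 := sq_nonneg _
      have e : (σ * (w * y ^ 2 * r) / 2 - 2 * lam / σ) ^ 2 =
        σ ^ 2 * (w ^ 2 * (y ^ 4 * r ^ 2 / 4)) - 2 * lam * y ^ 2 * (w * r)
          + 4 * lam ^ 2 / σ ^ 2 := by field_simp; ring
      linarith
    have hpos : 0 ≤ 2 * lam * Y ^ 2 * (W * r)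
      + σ ^ 2 * (W ^ 2 * (4 * Y ^ 3 * r ^ 2 + D * Y ^ 2)) := by positivity
    linarith
  · have hsr : s ≤ r ^ 2 := by
      have : 0 < y⁻¹ := by positivity
      linarith
    have h1 : 2 * lam * y ^ 2 * (w * r) ≤ 2 * lam * Y ^ 2 * (W * r) := by gcongr
    have h2 : w ^ 2 * (4 * y ^ 3 * s + D * y ^ 2) ≤ W ^ 2 * (4 * Y ^ 3 * r ^ 2 + D * Y ^ 2) := by
      gcongr
    have h3 := mul_le_mul_of_nonneg_left h2 (by positivity : 0 ≤ σ ^ 2)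
    have h4 : 0 ≤ σ ^ 2 * (w ^ 2 * (2 * y ^ 4 * s)) := by positivity
    have h5 : 0 ≤ 4 * lam ^ 2 / σ ^ 2 := by positivity
    linarith

/-- The bump `exp (-1 / (r² - ‖θ - θ₀‖²))` is a subsolution: its generator is at least `-p` times
itself, uniformly over consensus points at distance at most `B` from `θ₀`. -/
theorem exists_bump_generator_bound (d : ℕ) {lam σ r B : ℝ} (hlam : 0 < lam) (hσ : 0 < σ)
    (hr : 0 < r) (hB : 0 ≤ B) :
    ∃ p : ℝ, 0 ≤ p ∧ ∀ θ₀ m θ : E d, ‖m - θ₀‖ ≤ B →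
      -p * expNegInvGlue (r ^ 2 - ‖θ - θ₀‖ ^ 2) ≤ radialGenerator lam σ θ₀ m
        (fun s => -((r ^ 2 - s)⁻¹ ^ 2 * expNegInvGlue (r ^ 2 - s)))
        (fun s => ((r ^ 2 - s)⁻¹ ^ 4 - 2 * (r ^ 2 - s)⁻¹ ^ 3) * expNegInvGlue (r ^ 2 - s)) θ := by
  obtain ⟨p, hp, h⟩ := exists_generator_quotient_bound d lam σ r (r + B) (by positivity)
    hlam hσ hr (by positivity)
  refine ⟨p, hp, fun θ₀ m θ hm => ?_⟩
  rcases le_or_gt (r ^ 2) (‖θ - θ₀‖ ^ 2) with hs | hs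
  · simp [radialGenerator, expNegInvGlue.zero_of_nonpos (sub_nonpos.2 hs)]
  · have hx : ‖θ - θ₀‖ ≤ r := (abs_le_of_sq_le_sq' hs.le hr.le).2
    have hw : ‖θ - m‖ ≤ r + B := by
      have := norm_sub_le_norm_sub_add_norm_sub θ θ₀ m
      rw [norm_sub_rev θ₀ m] at this
      linarith
    have hi : |inner ℝ (θ - m) (θ - θ₀)| ≤ ‖θ - m‖ * r :=
      (abs_real_inner_le_norm _ _).trans (by gcongr)
    have key := h (r ^ 2 - ‖θ - θ₀‖ ^ 2)⁻¹ (‖θ - θ₀‖ ^ 2) ‖θ - m‖ _ (inv_pos.2 (sub_pos.2 hs))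
      (by positivity) (by rw [inv_inv]; ring) (norm_nonneg _) hw hi
    have hg := expNegInvGlue.nonneg (r ^ 2 - ‖θ - θ₀‖ ^ 2)
    have := mul_le_mul_of_nonneg_right key hg
    refine this.trans (le_of_eq ?_)
    simp only [radialGenerator]
    ring

end Bump

/-- Grönwall from below. -/
theorem mul_exp_le_of_deriv_ge {f f' : ℝ → ℝ} {T k : ℝ} (hf : ContinuousOn f (Icc 0 T))
    (hf' : ∀ t ∈ Ioo 0 T, HasDerivAt f (f' t) t) (h : ∀ t ∈ Ioo 0 T, -k * f t ≤ f' t) :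
    ∀ t ∈ Icc 0 T, f 0 * Real.exp (-k * t) ≤ f t := by
  intro t ht
  have hderiv : ∀ s ∈ Ioo 0 T, HasDerivAt (fun s => f s * Real.exp (k * s))
      (f' s * Real.exp (k * s) + f s * (Real.exp (k * s) * k)) s := fun s hs => by
    refine (hf' s hs).mul ?_
    simpa using ((hasDerivAt_id s).const_mul k).exp
  have hmono : MonotoneOn (fun s => f s * Real.exp (k * s)) (Icc 0 T) := by
    refine monotoneOn_of_deriv_nonneg (convex_Icc 0 T) (by fun_prop) ?_ ?_
    · rw [interior_Icc]
      exact fun s hs => (hderiv s hs).differentiableAt.differentiableWithinAt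
    · rw [interior_Icc]
      intro s hs
      rw [(hderiv s hs).deriv]
      have := mul_le_mul_of_nonneg_right (h s hs) (Real.exp_pos (k * s)).le
      linarith
  have h0 := hmono ⟨le_rfl, ht.1.trans ht.2⟩ ht ht.1
  simp only [mul_zero, Real.exp_zero, mul_one] at h0
  calc f 0 * Real.exp (-k * t) ≤ f t * Real.exp (k * t) * Real.exp (-k * t) := by gcongr
    _ = f t := by
      rw [mul_assoc, ← Real.exp_add]
      simp

/-- Grönwall from above. -/
theorem le_mul_exp_of_deriv_le {f f' : ℝ → ℝ} {T k : ℝ} (hf : ContinuousOn f (Icc 0 T))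
    (hf' : ∀ t ∈ Ioo 0 T, HasDerivAt f (f' t) t) (h : ∀ t ∈ Ioo 0 T, f' t ≤ -k * f t) :
    ∀ t ∈ Icc 0 T, f t ≤ f 0 * Real.exp (-k * t) := by
  intro t ht
  have := mul_exp_le_of_deriv_ge hf.neg (fun t ht => (hf' t ht).neg) (k := k)
    (fun t ht => by have := h t ht; simp only [Pi.neg_apply]; linarith) t ht
  simp only [Pi.neg_apply] at this
  linarith

/-- A ball around a point of the support of the initial datum keeps a uniformly positive mass, as
long as the consensus point stays bounded. -/
theorem exists_mass_lower_bound {d : ℕ} {lam σ : ℝ} (hlam : 0 < lam) (hσ : 0 < σ)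
    {ρ₀ : Measure (E d)} (hρ₀ : IsProbabilityMeasure ρ₀) {θ₀ : E d} (hsupp : θ₀ ∈ ρ₀.support)
    {r B : ℝ} (hr : 0 < r) (hB : 0 ≤ B) (T : ℝ) :
    ∃ c > 0, ∀ (m : ℝ → E d) (ρ : ℝ → Measure (E d)), IsWeakSolution lam σ T m ρ₀ ρ →
      ContinuousInP 4 T ρ → (∀ t ∈ Ioo 0 T, ‖m t - θ₀‖ ≤ B) →
      ∀ t ∈ Icc 0 T, ENNReal.ofReal c ≤ ρ t (Metric.closedBall θ₀ r) := by
  obtain ⟨p, hp, hgen⟩ := exists_bump_generator_bound d hlam hσ hr hB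
  have hsmooth : ContDiff ℝ ∞ fun s : ℝ => expNegInvGlue (r ^ 2 - s) :=
    expNegInvGlue.contDiff.comp (contDiff_const.sub contDiff_id)
  have hzero : ∀ s, r ^ 2 ≤ s → expNegInvGlue (r ^ 2 - s) = 0 := fun s hs =>
    expNegInvGlue.zero_of_nonpos (sub_nonpos.2 hs)
  have hcont : Continuous fun θ : E d => expNegInvGlue (r ^ 2 - ‖θ - θ₀‖ ^ 2) :=
    hsmooth.continuous.comp (by fun_prop)
  have hcs : HasCompactSupport fun θ : E d => expNegInvGlue (r ^ 2 - ‖θ - θ₀‖ ^ 2) :=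
    hasCompactSupport_radial θ₀ (c := r) fun θ h => hzero _ (by gcongr)
  have hpos : 0 < ∫ θ, expNegInvGlue (r ^ 2 - ‖θ - θ₀‖ ^ 2) ∂ρ₀ := by
    rw [integral_pos_iff_support_of_nonneg (fun θ => expNegInvGlue.nonneg _)
      (hcont.integrable_of_hasCompactSupport hcs)]
    rw [Measure.mem_support_iff_forall] at hsupp
    refine (hsupp _ (Metric.ball_mem_nhds θ₀ hr)).trans_le (measure_mono fun θ hθ => ?_)
    rw [Metric.mem_ball, dist_eq_norm] at hθ
    refine (expNegInvGlue.pos_of_pos (sub_pos.2 ?_)).ne'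
    gcongr
  refine ⟨(∫ θ, expNegInvGlue (r ^ 2 - ‖θ - θ₀‖ ^ 2) ∂ρ₀) * Real.exp (-p * T),
    by positivity, ?_⟩
  intro m ρ hw hc hm t ht
  have := fun t ht => (hc.1 t ht).1
  have hev : ∀ s ∈ Ioo 0 T, HasDerivAt (fun s => ∫ θ, expNegInvGlue (r ^ 2 - ‖θ - θ₀‖ ^ 2) ∂(ρ s))
      _ s := fun s hs => by
    have := this s (Ioo_subset_Icc_self hs)
    exact hw.hasDerivAt_radial hs hsmooth (hasDerivAt_expNegInvGlue_sub (r ^ 2))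
      (hasDerivAt_expNegInvGlue_sub_deriv (r ^ 2))
      (continuous_expNegInvGlue_sub_deriv_two (r ^ 2)) hr.le
      (fun s hs => by simp [hzero s hs])
  have hlow := mul_exp_le_of_deriv_ge
    (hc.continuousOn_integral_radial θ₀ hsmooth hr.le hzero) hev (k := p) (fun s hs => by
      have := this s (Ioo_subset_Icc_self hs)
      rw [← integral_const_mul]
      refine integral_mono ((hcont.integrable_of_hasCompactSupport hcs).const_mul _) ?_
        fun θ => hgen θ₀ (m s) θ (hm s hs)
      refine Continuous.integrable_of_hasCompactSupport (continuous_radialGenerator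
        (continuous_iff_continuousAt.2 fun s =>
          (hasDerivAt_expNegInvGlue_sub_deriv (r ^ 2) s).continuousAt)
        (continuous_expNegInvGlue_sub_deriv_two (r ^ 2)))
        (hasCompactSupport_radial θ₀ (c := r) fun θ h => ?_)
      simp [radialGenerator, hzero (‖θ - θ₀‖ ^ 2) (by gcongr)]) t ht
  rw [hw.initial] at hlow
  have := this t ht
  have hle : ∫ θ, expNegInvGlue (r ^ 2 - ‖θ - θ₀‖ ^ 2) ∂(ρ t)
      ≤ (ρ t).real (Metric.closedBall θ₀ r) := by
    rw [← integral_indicator_one Metric.isClosed_closedBall.measurableSet]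
    refine integral_mono (hcont.integrable_of_hasCompactSupport hcs)
      ((integrable_const (1 : ℝ)).indicator Metric.isClosed_closedBall.measurableSet) fun θ => ?_
    by_cases hθ : θ ∈ Metric.closedBall θ₀ r
    · simpa [hθ] using expNegInvGlue_le_one _
    · simp only [indicator_of_notMem hθ]
      rw [Metric.mem_closedBall, dist_eq_norm, not_le] at hθ
      exact (hzero _ (by gcongr)).le
  rw [← ofReal_measureReal]
  refine ENNReal.ofReal_le_ofReal (le_trans ?_ (hlow.trans hle))
  have : -p * T ≤ -p * t := by nlinarith [ht.2]
  gcongr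

/-! ### Evolution of the second moment -/

/-- A smooth truncation of the identity: `s` for `s ≤ 1` and `0` for `s ≥ 2`. -/
noncomputable def truncId (s : ℝ) : ℝ := s * Real.smoothTransition (2 - s)

theorem contDiff_truncId : ContDiff ℝ ∞ truncId :=
  contDiff_id.mul (Real.smoothTransition.contDiff.comp (contDiff_const.sub contDiff_id))

theorem truncId_of_le_one {s : ℝ} (hs : s ≤ 1) : truncId s = s := by
  rw [truncId, Real.smoothTransition.one_of_one_le (by linarith), mul_one]

theorem truncId_of_two_le {s : ℝ} (hs : 2 ≤ s) : truncId s = 0 := by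
  rw [truncId, Real.smoothTransition.zero_of_nonpos (by linarith), mul_zero]

theorem hasDerivAt_truncId (s : ℝ) : HasDerivAt truncId (deriv truncId s) s :=
  (contDiff_truncId.differentiable (by simp) s).hasDerivAt

theorem contDiff_deriv_truncId : ContDiff ℝ ∞ (deriv truncId) :=
  (contDiff_infty_iff_deriv.1 contDiff_truncId).2

theorem hasDerivAt_deriv_truncId (s : ℝ) :
    HasDerivAt (deriv truncId) (deriv (deriv truncId) s) s :=
  (contDiff_deriv_truncId.differentiable (by simp) s).hasDerivAt

theorem continuous_deriv_deriv_truncId : Continuous (deriv (deriv truncId)) :=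
  (contDiff_infty_iff_deriv.1 contDiff_deriv_truncId).2.continuous

theorem deriv_truncId_of_lt_one {s : ℝ} (hs : s < 1) : deriv truncId s = 1 := by
  have : truncId =ᶠ[𝓝 s] id := by
    filter_upwards [gt_mem_nhds hs] with y hy using truncId_of_le_one (le_of_lt hy)
  rw [this.deriv_eq, deriv_id]

theorem deriv_deriv_truncId_of_lt_one {s : ℝ} (hs : s < 1) : deriv (deriv truncId) s = 0 := by
  have : deriv truncId =ᶠ[𝓝 s] fun _ => 1 := by
    filter_upwards [gt_mem_nhds hs] with y hy using deriv_truncId_of_lt_one hy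
  rw [this.deriv_eq, deriv_const]

theorem deriv_truncId_of_two_lt {s : ℝ} (hs : 2 < s) :
    deriv truncId s = 0 ∧ deriv (deriv truncId) s = 0 := by
  have h1 : ∀ y, 2 < y → deriv truncId y = 0 := fun y hy => by
    have : truncId =ᶠ[𝓝 y] fun _ => 0 := by
      filter_upwards [lt_mem_nhds hy] with z hz using truncId_of_two_le (le_of_lt hz)
    rw [this.deriv_eq, deriv_const]
  refine ⟨h1 s hs, ?_⟩
  have : deriv truncId =ᶠ[𝓝 s] fun _ => 0 := by
    filter_upwards [lt_mem_nhds hs] with y hy using h1 y hy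
  rw [this.deriv_eq, deriv_const]

theorem exists_truncId_deriv_bound : ∃ K : ℝ, 0 ≤ K ∧ ∀ s, 0 ≤ s →
    |deriv truncId s - 1| ≤ K ∧ |s * deriv (deriv truncId) s| ≤ K := by
  obtain ⟨K₁, h1⟩ := isCompact_Icc.exists_bound_of_continuousOn (s := Icc (0 : ℝ) 2)
    (f := fun s => deriv truncId s - 1) (contDiff_deriv_truncId.continuous.sub
      continuous_const).continuousOn
  obtain ⟨K₂, h2⟩ := isCompact_Icc.exists_bound_of_continuousOn (s := Icc (0 : ℝ) 2)
    (f := fun s => s * deriv (deriv truncId) s)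
    (continuous_id.mul continuous_deriv_deriv_truncId).continuousOn
  refine ⟨max 1 (max K₁ K₂), by positivity, fun s hs => ?_⟩
  rcases le_or_gt s 2 with h | h
  · exact ⟨(h1 s ⟨hs, h⟩).trans (by simp), (h2 s ⟨hs, h⟩).trans (by simp)⟩
  · rw [(deriv_truncId_of_two_lt h).1, (deriv_truncId_of_two_lt h).2]
    simp

/-- Replacing the profile `s` by its truncation `N · truncId (s / N)` changes the generator by at
most a multiple of `‖θ - θ₀‖⁴ / N`: the two agree where `‖θ - θ₀‖² < N`, and both have at most
quadratic growth. -/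
theorem exists_radialGenerator_truncId_sub_le (d : ℕ) {lam σ B : ℝ} (hlam : 0 < lam)
    (hB : 0 ≤ B) :
    ∃ C : ℝ, 0 ≤ C ∧ ∀ (θ₀ m θ : E d) (N : ℝ), ‖m - θ₀‖ ≤ B → 1 ≤ N →
      ‖radialGenerator lam σ θ₀ m (fun s => deriv truncId (s / N))
          (fun s => deriv (deriv truncId) (s / N) / N) θ
        - radialGenerator lam σ θ₀ m (fun _ => 1) (fun _ => 0) θ‖ ≤ C / N * ‖θ - θ₀‖ ^ 4 := by
  obtain ⟨K, hK, hbound⟩ := exists_truncId_deriv_bound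
  refine ⟨2 * lam * K * (1 + B) + σ ^ 2 / 2 * ((2 + 2 * B ^ 2) * (4 * K + 2 * d * K)),
    by positivity, fun θ₀ m θ N hm hN => ?_⟩
  have hN0 : 0 < N := by linarith
  set x := ‖θ - θ₀‖ with hx
  have hx0 : 0 ≤ x := norm_nonneg _
  rcases lt_or_ge (x ^ 2) N with h | h
  · have h1 : x ^ 2 / N < 1 := (div_lt_one hN0).2 h
    have : radialGenerator lam σ θ₀ m (fun s => deriv truncId (s / N))
          (fun s => deriv (deriv truncId) (s / N) / N) θ
        = radialGenerator lam σ θ₀ m (fun _ => 1) (fun _ => 0) θ := by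
      simp only [radialGenerator, ← hx, deriv_truncId_of_lt_one h1,
        deriv_deriv_truncId_of_lt_one h1]
      ring
    rw [this, sub_self, norm_zero]
    positivity
  · obtain ⟨hb1, hb2⟩ := hbound (x ^ 2 / N) (by positivity)
    set A := deriv truncId (x ^ 2 / N) - 1 with hA
    set A' := x ^ 2 / N * deriv (deriv truncId) (x ^ 2 / N) with hA'
    have hx1 : 1 ≤ x := by
      by_contra hcon
      push Not at hcon
      have : x ^ 2 < 1 := by nlinarith
      linarith
    have hw : ‖θ - m‖ ≤ x + B := by
      have := norm_sub_le_norm_sub_add_norm_sub θ θ₀ m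
      rw [norm_sub_rev θ₀ m] at this
      linarith
    have hi : |inner ℝ (θ - m) (θ - θ₀)| ≤ (1 + B) * x ^ 2 := by
      calc |inner ℝ (θ - m) (θ - θ₀)| ≤ ‖θ - m‖ * x := abs_real_inner_le_norm _ _
        _ ≤ (x + B) * x := by gcongr
        _ ≤ (1 + B) * x ^ 2 := by nlinarith [mul_nonneg hB (mul_nonneg hx0 (sub_nonneg.2 hx1))]
    have hw2 : ‖θ - m‖ ^ 2 ≤ (2 + 2 * B ^ 2) * x ^ 2 := by
      calc ‖θ - m‖ ^ 2 ≤ (x + B) ^ 2 := by gcongr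
        _ ≤ 2 * x ^ 2 + 2 * B ^ 2 * 1 := by nlinarith [sq_nonneg (x - B)]
        _ ≤ 2 * x ^ 2 + 2 * B ^ 2 * x ^ 2 := by
          gcongr
          nlinarith
        _ = _ := by ring
    have e : radialGenerator lam σ θ₀ m (fun s => deriv truncId (s / N))
          (fun s => deriv (deriv truncId) (s / N) / N) θ
        - radialGenerator lam σ θ₀ m (fun _ => 1) (fun _ => 0) θ
        = -(2 * lam * A * inner ℝ (θ - m) (θ - θ₀))
          + σ ^ 2 / 2 * (‖θ - m‖ ^ 2 * (4 * A' + 2 * d * A)) := by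
      simp only [radialGenerator, ← hx, hA, hA']
      field_simp
      ring
    rw [e]
    have hA1 : |2 * lam * A * inner ℝ (θ - m) (θ - θ₀)| ≤ 2 * lam * K * ((1 + B) * x ^ 2) := by
      rw [abs_mul, abs_mul, abs_of_pos (by positivity : 0 < 2 * lam)]
      gcongr
    have hA2 : |4 * A' + 2 * d * A| ≤ 4 * K + 2 * d * K := by
      refine (abs_add_le _ _).trans ?_
      rw [abs_mul 4, abs_mul (2 * (d : ℝ)), abs_of_pos (by norm_num : (0 : ℝ) < 4),
        abs_of_nonneg (by positivity : (0 : ℝ) ≤ 2 * d)]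
      gcongr
    have hA3 : |σ ^ 2 / 2 * (‖θ - m‖ ^ 2 * (4 * A' + 2 * d * A))|
        ≤ σ ^ 2 / 2 * ((2 + 2 * B ^ 2) * x ^ 2 * (4 * K + 2 * d * K)) := by
      rw [abs_mul, abs_mul, abs_of_nonneg (by positivity : 0 ≤ σ ^ 2 / 2),
        abs_of_nonneg (by positivity : 0 ≤ ‖θ - m‖ ^ 2)]
      gcongr
    have hx4 : x ^ 2 ≤ x ^ 4 / N := by
      rw [le_div_iff₀ hN0]
      calc x ^ 2 * N ≤ x ^ 2 * x ^ 2 := by gcongr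
        _ = x ^ 4 := by ring
    calc _ ≤ 2 * lam * K * ((1 + B) * x ^ 2)
          + σ ^ 2 / 2 * ((2 + 2 * B ^ 2) * x ^ 2 * (4 * K + 2 * d * K)) := by
            refine (norm_add_le _ _).trans ?_
            rw [norm_neg]
            exact add_le_add hA1 hA3
      _ = (2 * lam * K * (1 + B) + σ ^ 2 / 2 * ((2 + 2 * B ^ 2) * (4 * K + 2 * d * K)))
          * x ^ 2 := by ring
      _ ≤ (2 * lam * K * (1 + B) + σ ^ 2 / 2 * ((2 + 2 * B ^ 2) * (4 * K + 2 * d * K)))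
          * (x ^ 4 / N) := by gcongr
      _ = _ := by ring

theorem abs_truncId_sub_le {s N : ℝ} (hs : 0 ≤ s) (hN : 0 < N) :
    |N * truncId (s / N) - s| ≤ 1 / N * s ^ 2 := by
  rcases le_or_gt s N with h | h
  · rw [truncId_of_le_one ((div_le_one hN).2 h), mul_div_cancel₀ _ hN.ne', sub_self, abs_zero]
    positivity
  · have h0 := Real.smoothTransition.nonneg (2 - s / N)
    have h1 := Real.smoothTransition.le_one (2 - s / N)
    have e : N * truncId (s / N) - s = -(s * (1 - Real.smoothTransition (2 - s / N))) := by
      rw [truncId]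
      field_simp
      ring
    have h2 : s ≤ 1 / N * s ^ 2 := by
      rw [one_div, inv_mul_eq_div, le_div_iff₀ hN]
      nlinarith
    rw [e, abs_neg, abs_of_nonneg (mul_nonneg hs (by linarith))]
    nlinarith [mul_nonneg hs h0]

section Moment

variable {d : ℕ} {T : ℝ} {ρ : ℝ → Measure (E d)} (θ₀ : E d)

theorem integrable_sq_of_integrable_pow_four {μ : Measure (E d)} [IsFiniteMeasure μ]
    (h : Integrable (fun θ => ‖θ - θ₀‖ ^ 4) μ) : Integrable (fun θ => ‖θ - θ₀‖ ^ 2) μ := by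
  refine ((integrable_const (1 : ℝ)).add h).mono' (by fun_prop) (ae_of_all _ fun θ => ?_)
  rw [Real.norm_of_nonneg (by positivity)]
  simp only [Pi.add_apply]
  nlinarith [sq_nonneg (‖θ - θ₀‖ ^ 2 - 1)]

/-- Integrands that converge at rate `‖θ - θ₀‖⁴ / n` have integrals that converge uniformly over any
set of times on which the fourth moments are bounded. -/
theorem tendstoUniformlyOn_integral_of_le {S : Set ℝ} {M C : ℝ} (hC : 0 ≤ C)
    (hM : ∀ t ∈ S, Integrable (fun θ => ‖θ - θ₀‖ ^ 4) (ρ t) ∧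
      ∫ θ, ‖θ - θ₀‖ ^ 4 ∂(ρ t) ≤ M)
    {f : ℕ → ℝ → E d → ℝ} {g : ℝ → E d → ℝ} (hf : ∀ n, ∀ t ∈ S, Integrable (f n t) (ρ t))
    (hg : ∀ t ∈ S, AEStronglyMeasurable (g t) (ρ t))
    (h : ∀ n, ∀ t ∈ S, ∀ θ, ‖f n t θ - g t θ‖ ≤ C / (n + 1) * ‖θ - θ₀‖ ^ 4) :
    (∀ t ∈ S, Integrable (g t) (ρ t)) ∧
    TendstoUniformlyOn (fun n t => ∫ θ, f n t θ ∂(ρ t)) (fun t => ∫ θ, g t θ ∂(ρ t)) atTop S := by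
  have hgi : ∀ t ∈ S, Integrable (g t) (ρ t) := fun t ht => by
    have hsub : Integrable (fun θ => f 0 t θ - g t θ) (ρ t) :=
      ((hM t ht).1.const_mul (C / ((0 : ℕ) + 1))).mono'
        ((hf 0 t ht).aestronglyMeasurable.sub (hg t ht)) (ae_of_all _ (h 0 t ht))
    refine ((hf 0 t ht).sub hsub).congr (ae_of_all _ fun θ => ?_)
    simp
  refine ⟨hgi, ?_⟩
  rw [Metric.tendstoUniformlyOn_iff]
  intro ε hε
  have hlim : Tendsto (fun n : ℕ => C * M * (1 / ((n : ℝ) + 1))) atTop (𝓝 0) := by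
    simpa using tendsto_one_div_add_atTop_nhds_zero_nat.const_mul (C * M)
  filter_upwards [hlim.eventually (gt_mem_nhds hε)] with n hn t ht
  rw [dist_comm, Real.dist_eq, ← integral_sub (hf n t ht) (hgi t ht)]
  refine lt_of_le_of_lt ?_ hn
  calc |∫ θ, (f n t θ - g t θ) ∂(ρ t)| ≤ ∫ θ, C / (n + 1) * ‖θ - θ₀‖ ^ 4 ∂(ρ t) :=
        norm_integral_le_of_norm_le ((hM t ht).1.const_mul _) (ae_of_all _ (h n t ht))
    _ = C / (n + 1) * ∫ θ, ‖θ - θ₀‖ ^ 4 ∂(ρ t) := integral_const_mul _ _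
    _ ≤ C / (n + 1) * M := by
      gcongr
      exact (hM t ht).2
    _ = _ := by ring

theorem contDiff_scaled_truncId (N : ℝ) : ContDiff ℝ ∞ fun s => N * truncId (s / N) :=
  contDiff_const.mul (contDiff_truncId.comp (contDiff_id.div_const N))

theorem scaled_truncId_eq_zero {N s : ℝ} (hN : 0 < N) (hs : (√(3 * N)) ^ 2 ≤ s) :
    N * truncId (s / N) = 0 ∧ deriv truncId (s / N) = 0 ∧
      deriv (deriv truncId) (s / N) / N = 0 := by
  rw [Real.sq_sqrt (by positivity)] at hs
  have : 2 < s / N := by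
    rw [lt_div_iff₀ hN]
    linarith
  rw [truncId_of_two_le this.le, (deriv_truncId_of_two_lt this).1, (deriv_truncId_of_two_lt this).2]
  simp

theorem tendstoUniformlyOn_truncated_secondMoment {S : Set ℝ} {M : ℝ}
    (hM : ∀ t ∈ S, Integrable (fun θ => ‖θ - θ₀‖ ^ 4) (ρ t) ∧
      ∫ θ, ‖θ - θ₀‖ ^ 4 ∂(ρ t) ≤ M) (hfin : ∀ t ∈ S, IsFiniteMeasure (ρ t)) :
    TendstoUniformlyOn (fun (n : ℕ) t => ∫ θ, ((n : ℝ) + 1) *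
      truncId (‖θ - θ₀‖ ^ 2 / ((n : ℝ) + 1)) ∂(ρ t)) (fun t => ∫ θ, ‖θ - θ₀‖ ^ 2 ∂(ρ t)) atTop S := by
  refine (tendstoUniformlyOn_integral_of_le θ₀ zero_le_one hM (fun n t ht => ?_)
    (fun t ht => by fun_prop) fun n t ht θ => ?_).2
  · have := hfin t ht
    have := contDiff_truncId.continuous
    refine Continuous.integrable_of_hasCompactSupport (by fun_prop)
      (hasCompactSupport_radial θ₀ (c := √(3 * (n + 1))) fun θ h => ?_)
    exact (scaled_truncId_eq_zero (by positivity) (by gcongr)).1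
  · refine (abs_truncId_sub_le (by positivity) (by positivity)).trans (le_of_eq ?_)
    ring

theorem ContinuousInP.continuousOn_secondMoment (hρ : ContinuousInP 4 T ρ) :
    ContinuousOn (fun t => ∫ θ, ‖θ - θ₀‖ ^ 2 ∂(ρ t)) (Icc 0 T) := by
  obtain ⟨M, hM⟩ := hρ.exists_moment_bound θ₀
  refine (tendstoUniformlyOn_truncated_secondMoment θ₀ hM fun t ht => by
    have := (hρ.1 t ht).1; infer_instance).continuousOn (Frequently.of_forall fun n => ?_)
  exact hρ.continuousOn_integral_radial θ₀ (contDiff_scaled_truncId _) (Real.sqrt_nonneg _)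
    fun s hs => (scaled_truncId_eq_zero (by positivity) hs).1

/-- The weak formulation extends to the test function `‖θ - θ₀‖²`, by truncation and uniform
convergence of the derivatives. -/
theorem IsWeakSolution.hasDerivAt_secondMoment {lam σ B : ℝ} {m : ℝ → E d} {ρ₀ : Measure (E d)}
    (hw : IsWeakSolution lam σ T m ρ₀ ρ) (hρ : ContinuousInP 4 T ρ) (hlam : 0 < lam)
    (hB : 0 ≤ B) (hm : ∀ t ∈ Ioo 0 T, ‖m t - θ₀‖ ≤ B) {t : ℝ} (ht : t ∈ Ioo 0 T) :
    Integrable (radialGenerator lam σ θ₀ (m t) (fun _ => 1) fun _ => 0) (ρ t) ∧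
    HasDerivAt (fun s => ∫ θ, ‖θ - θ₀‖ ^ 2 ∂(ρ s))
      (∫ θ, radialGenerator lam σ θ₀ (m t) (fun _ => 1) (fun _ => 0) θ ∂(ρ t)) t := by
  obtain ⟨M, hM⟩ := hρ.exists_moment_bound θ₀
  obtain ⟨C, hC, hgen⟩ := exists_radialGenerator_truncId_sub_le (σ := σ) d hlam hB
  have hM' : ∀ t ∈ Ioo 0 T, _ := fun t ht => hM t (Ioo_subset_Icc_self ht)
  have hfin : ∀ t ∈ Ioo 0 T, IsFiniteMeasure (ρ t) := fun t ht => by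
    have := (hρ.1 t (Ioo_subset_Icc_self ht)).1
    infer_instance
  have hc1 := contDiff_deriv_truncId.continuous
  have hc2 := continuous_deriv_deriv_truncId
  have key := tendstoUniformlyOn_integral_of_le θ₀ hC hM'
    (f := fun n t => radialGenerator lam σ θ₀ (m t)
      (fun s => deriv truncId (s / ((n : ℝ) + 1)))
      (fun s => deriv (deriv truncId) (s / ((n : ℝ) + 1)) / ((n : ℝ) + 1)))
    (g := fun t => radialGenerator lam σ θ₀ (m t) (fun _ => 1) fun _ => 0)
    (fun n t ht => by
      have := hfin t ht
      refine Continuous.integrable_of_hasCompactSupport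
        (continuous_radialGenerator (by fun_prop) (by fun_prop))
        (hasCompactSupport_radial θ₀ (c := √(3 * (n + 1))) fun θ h => ?_)
      obtain ⟨-, h1, h2⟩ := scaled_truncId_eq_zero (N := n + 1) (s := ‖θ - θ₀‖ ^ 2)
        (by positivity) (by gcongr)
      simp only [radialGenerator, h1, h2]
      ring)
    (fun t ht => (continuous_radialGenerator continuous_const
      continuous_const).aestronglyMeasurable)
    (fun n t ht θ => hgen θ₀ (m t) θ _ (hm t ht) (by simp))
  refine ⟨key.1 t ht, ?_⟩
  refine hasDerivAt_of_tendstoUniformlyOn isOpen_Ioo key.2 (Eventually.of_forall fun n s hs => ?_)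
    (fun s hs => (tendstoUniformlyOn_truncated_secondMoment θ₀ hM' hfin).tendsto_at hs) ht
  have := hfin s hs
  have hN : (0 : ℝ) < n + 1 := by positivity
  refine hw.hasDerivAt_radial hs (contDiff_scaled_truncId _) (fun y => ?_) (fun y => ?_)
    (by fun_prop) (Real.sqrt_nonneg _) fun y hy => scaled_truncId_eq_zero hN hy
  · refine (((hasDerivAt_truncId (y / (n + 1))).comp y
      ((hasDerivAt_id y).div_const ((n : ℝ) + 1))).const_mul ((n : ℝ) + 1)).congr_deriv ?_
    field_simp
  · refine ((hasDerivAt_deriv_truncId (y / (n + 1))).comp y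
      ((hasDerivAt_id y).div_const ((n : ℝ) + 1))).congr_deriv ?_
    ring

/-- When the consensus point is within `c √ε` of `θ₀` and the second moment is at least `ε`, the
second moment decays at rate `2λ - dσ²` up to a small relative error. -/
theorem abs_integral_radialGenerator_add_le {lam σ c ε : ℝ} {m : E d} {μ : Measure (E d)}
    [IsProbabilityMeasure μ] (hlam : 0 < lam) (hc : 0 ≤ c) (hc1 : c ≤ 1) (hε : 0 < ε)
    (hm : ‖m - θ₀‖ ≤ c * √ε) (h2 : Integrable (fun θ => ‖θ - θ₀‖ ^ 2) μ)
    (hg : Integrable (radialGenerator lam σ θ₀ m (fun _ => 1) fun _ => 0) μ)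
    (hV : ε ≤ ∫ θ, ‖θ - θ₀‖ ^ 2 ∂μ) :
    |(∫ θ, radialGenerator lam σ θ₀ m (fun _ => 1) (fun _ => 0) θ ∂μ)
      + (2 * lam - d * σ ^ 2) * ∫ θ, ‖θ - θ₀‖ ^ 2 ∂μ|
      ≤ (2 * lam + 3 * (d * σ ^ 2)) * c * ∫ θ, ‖θ - θ₀‖ ^ 2 ∂μ := by
  set V := ∫ θ, ‖θ - θ₀‖ ^ 2 ∂μ with hVdef
  have hdσ : 0 ≤ d * σ ^ 2 := by positivity
  have hpt : ∀ θ, ‖radialGenerator lam σ θ₀ m (fun _ => 1) (fun _ => 0) θ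
      + (2 * lam - d * σ ^ 2) * ‖θ - θ₀‖ ^ 2‖
      ≤ (2 * lam + 2 * (d * σ ^ 2)) * (c / 2 * (ε + ‖θ - θ₀‖ ^ 2)) + d * σ ^ 2 * (c * ε) := by
    intro θ
    set x := θ - θ₀ with hx
    set n := m - θ₀ with hn
    have e0 : θ - m = x - n := by rw [hx, hn]; abel
    have e : radialGenerator lam σ θ₀ m (fun _ => 1) (fun _ => 0) θ
        + (2 * lam - d * σ ^ 2) * ‖x‖ ^ 2
        = (2 * lam - 2 * (d * σ ^ 2)) * inner ℝ n x + d * σ ^ 2 * ‖n‖ ^ 2 := by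
      simp only [radialGenerator, ← hx, e0]
      rw [norm_sub_sq_real, inner_sub_left, real_inner_self_eq_norm_sq, real_inner_comm n x]
      ring
    have hnx : |inner ℝ n x| ≤ c / 2 * (ε + ‖x‖ ^ 2) := by
      calc |inner ℝ n x| ≤ ‖n‖ * ‖x‖ := abs_real_inner_le_norm _ _
        _ ≤ c * √ε * ‖x‖ := by gcongr
        _ = c / 2 * (2 * √ε * ‖x‖) := by ring
        _ ≤ c / 2 * (ε + ‖x‖ ^ 2) := by
          gcongr
          have := two_mul_le_add_sq (√ε) ‖x‖
          rwa [Real.sq_sqrt hε.le] at this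
    have hn2 : ‖n‖ ^ 2 ≤ c * ε := by
      calc ‖n‖ ^ 2 ≤ (c * √ε) ^ 2 := by gcongr
        _ = c * c * ε := by rw [mul_pow, Real.sq_sqrt hε.le]; ring
        _ ≤ 1 * c * ε := by gcongr
        _ = c * ε := by ring
    have hco : |2 * lam - 2 * (d * σ ^ 2)| ≤ 2 * lam + 2 * (d * σ ^ 2) := by
      rw [abs_le]; constructor <;> linarith
    rw [e]
    refine (norm_add_le _ _).trans ?_
    rw [norm_mul, norm_mul, Real.norm_of_nonneg hdσ, Real.norm_of_nonneg (sq_nonneg ‖n‖)]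
    exact add_le_add (mul_le_mul hco hnx (abs_nonneg _) (by positivity)) (by gcongr)
  have hint₀ : Integrable (fun θ => ε + ‖θ - θ₀‖ ^ 2) μ := (integrable_const ε).add h2
  have hint : Integrable (fun θ => (2 * lam + 2 * (d * σ ^ 2)) * (c / 2 * (ε + ‖θ - θ₀‖ ^ 2))
      + d * σ ^ 2 * (c * ε)) μ :=
    ((hint₀.const_mul _).const_mul _).add (integrable_const _)
  have e1 : (∫ θ, radialGenerator lam σ θ₀ m (fun _ => 1) (fun _ => 0) θ ∂μ)
      + (2 * lam - d * σ ^ 2) * V = ∫ θ, (radialGenerator lam σ θ₀ m (fun _ => 1) (fun _ => 0) θ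
      + (2 * lam - d * σ ^ 2) * ‖θ - θ₀‖ ^ 2) ∂μ := by
    rw [integral_add hg (h2.const_mul _), integral_const_mul]
  rw [e1]
  refine (norm_integral_le_of_norm_le hint (ae_of_all _ hpt)).trans ?_
  rw [integral_add ((hint₀.const_mul _).const_mul _) (integrable_const _),
    integral_const_mul, integral_const_mul, integral_add (integrable_const ε) h2, ← hVdef]
  simp only [integral_const, probReal_univ, one_smul]
  calc (2 * lam + 2 * (d * σ ^ 2)) * (c / 2 * (ε + V)) + d * σ ^ 2 * (c * ε)
      ≤ (2 * lam + 2 * (d * σ ^ 2)) * (c / 2 * (V + V)) + d * σ ^ 2 * (c * V) := by gcongr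
    _ = _ := by ring

end Moment

/-! ### Quantiles and the Laplace principle for the consensus point -/

section Consensus

variable {d : ℕ} {L G : E d → ℝ} {ϱ : Measure (E d)}

theorem quantile_bddBelow {l a : ℝ} (hl : ∀ θ, l ≤ L θ) (ha : 0 < a) :
    l ∈ lowerBounds {q : ℝ | ENNReal.ofReal a ≤ ϱ {θ | L θ ≤ q}} := by
  intro q hq
  by_contra hlt
  push Not at hlt
  have : {θ | L θ ≤ q} = ∅ := by
    ext θ
    simpa using hlt.trans_le (hl θ)
  rw [mem_ofPred_eq, this, measure_empty] at hq
  exact absurd hq (not_le.2 (ENNReal.ofReal_pos.2 ha))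

/-- If the sublevel set `{L ≤ l + δ}` has mass at least `β`, the averaged quantile lies between
`l ≤ inf L` and `l + δ`. -/
theorem quantile_average_mem_Icc {l δ β : ℝ} (hl : ∀ θ, l ≤ L θ) (hβ : 0 < β)
    (hmass : ENNReal.ofReal β ≤ ϱ {θ | L θ ≤ l + δ}) :
    2 / β * (∫ a in (β / 2)..β, quantile L ϱ a) ∈ Icc l (l + δ) := by
  have hmem : ∀ a ≤ β, l + δ ∈ {q : ℝ | ENNReal.ofReal a ≤ ϱ {θ | L θ ≤ q}} := fun a ha =>
    (ENNReal.ofReal_le_ofReal ha).trans hmass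
  have hpos : ∀ a ∈ Icc (β / 2) β, 0 < a := fun a ha => by linarith [ha.1]
  have hlow : ∀ a ∈ Icc (β / 2) β, l ≤ quantile L ϱ a := fun a ha =>
    le_csInf ⟨_, hmem a ha.2⟩ (quantile_bddBelow hl (hpos a ha))
  have hup : ∀ a ∈ Icc (β / 2) β, quantile L ϱ a ≤ l + δ := fun a ha =>
    csInf_le ⟨_, quantile_bddBelow hl (hpos a ha)⟩ (hmem a ha.2)
  have hmono : MonotoneOn (quantile L ϱ) (Icc (β / 2) β) := fun a ha b hb hab =>
    csInf_le_csInf ⟨_, quantile_bddBelow hl (hpos a ha)⟩ ⟨_, hmem b hb.2⟩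
      fun q hq => (ENNReal.ofReal_le_ofReal hab).trans hq
  have hle : β / 2 ≤ β := by linarith
  have hint : IntervalIntegrable (quantile L ϱ) volume (β / 2) β :=
    MonotoneOn.intervalIntegrable (by rwa [uIcc_of_le hle])
  have h1 := intervalIntegral.integral_mono_on hle intervalIntegrable_const hint hlow
  have h2 := intervalIntegral.integral_mono_on hle hint intervalIntegrable_const hup
  rw [intervalIntegral.integral_const, smul_eq_mul] at h1 h2
  have e : ∀ x : ℝ, x = 2 / β * ((β - β / 2) * x) := fun x => by field_simp; ring
  constructor
  · rw [e l]
    gcongr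
  · rw [e (l + δ)]
    gcongr

theorem isClosed_subLevel (hL : Continuous L) (β δq R : ℝ) :
    IsClosed (subLevel L β δq R ϱ) :=
  Metric.isClosed_closedBall.inter (isClosed_le hL continuous_const)

theorem gibbs_pos (α : ℝ) (θ : E d) : 0 < gibbs G α θ := Real.exp_pos _

theorem integrable_quantiled [IsFiniteMeasure ϱ] {F : Type*} [NormedAddCommGroup F]
    {f : E d → F} (hf : Continuous f) (β δq R : ℝ) :
    Integrable f (quantiled L β δq R ϱ) := by
  have : IntegrableOn f (Metric.closedBall 0 R) ϱ :=
    hf.continuousOn.integrableOn_compact (isCompact_closedBall _ _)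
  exact this.mono_set fun θ hθ => hθ.1

theorem continuous_gibbs (hG : Continuous G) (α : ℝ) : Continuous (gibbs G α) := by
  unfold gibbs
  fun_prop

theorem integral_norm_gibbs (α : ℝ) (μ : Measure (E d)) :
    ∫ θ, ‖gibbs G α θ‖ ∂μ = ∫ θ, gibbs G α θ ∂μ :=
  integral_congr_ae (ae_of_all _ fun θ => Real.norm_of_nonneg (gibbs_pos α θ).le)

/-- The consensus point is an average over the ball of radius `R`, or `0`. -/
theorem norm_consensus_le [IsFiniteMeasure ϱ] (hL : Continuous L) (hG : Continuous G)
    (α β δq : ℝ) {R : ℝ} (hR : 0 ≤ R) : ‖consensus L G α β δq R ϱ‖ ≤ R := by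
  unfold consensus
  rw [integral_norm_gibbs]
  set ν := quantiled L β δq R ϱ with hν
  set Z := ∫ θ, gibbs G α θ ∂ν with hZ
  have hZ0 : 0 ≤ Z := integral_nonneg fun θ => (gibbs_pos α θ).le
  have hi : Integrable (fun θ => gibbs G α θ / Z * R) ν :=
    ((integrable_quantiled (continuous_gibbs hG α) β δq R).div_const Z).mul_const R
  refine (norm_integral_le_of_norm_le hi ?_).trans ?_
  · filter_upwards [ae_restrict_mem (isClosed_subLevel hL β δq R).measurableSet] with θ hθ
    have : ‖θ‖ ≤ R := by simpa using hθ.1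
    rw [norm_smul, Real.norm_of_nonneg (div_nonneg (gibbs_pos α θ).le hZ0)]
    have := div_nonneg (gibbs_pos (G := G) α θ).le hZ0
    gcongr
  · rw [integral_mul_const, integral_div]
    exact mul_le_of_le_one_left hR (div_self_le_one Z)

/-- Laplace principle. Points of the quantiled sublevel set outside the ball of radius `rG` have
Gibbs weight at most `exp (-α (Gt + g))`, while the ball of radius `r` has total weight at least
`κ exp (-α (Gt + g / 2))`. -/
theorem norm_consensus_sub_le [IsProbabilityMeasure ϱ] (hL : Continuous L) (hG : Continuous G)
    {θ₀ : E d} (hmin : ∀ θ, L θ₀ ≤ L θ) {δq R r rG Gt g κ α β : ℝ} (hδq : 0 < δq)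
    (hR : ‖θ₀‖ ≤ R) (hrG : 0 ≤ rG) (hα : 0 ≤ α) (hκ : 0 < κ) (hβ : 0 < β) (hβκ : β ≤ κ)
    (hball : Metric.closedBall θ₀ r ⊆ Metric.closedBall 0 R)
    (hLr : ∀ θ ∈ Metric.closedBall θ₀ r, L θ ≤ L θ₀ + δq / 2)
    (hGr : ∀ θ ∈ Metric.closedBall θ₀ r, G θ ≤ Gt + g / 2)
    (hfar : ∀ θ, L θ ≤ L θ₀ + 3 / 2 * δq → θ ∉ Metric.closedBall θ₀ rG → Gt + g ≤ G θ)
    (hmass : ENNReal.ofReal κ ≤ ϱ (Metric.closedBall θ₀ r)) :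
    ‖consensus L G α β δq R ϱ - θ₀‖ ≤ rG + 2 * R / κ * Real.exp (-(g / 2) * α) := by
  have hR0 : 0 ≤ R := (norm_nonneg _).trans hR
  have havg := quantile_average_mem_Icc (ϱ := ϱ) hmin hβ
    ((ENNReal.ofReal_le_ofReal hβκ).trans (hmass.trans (measure_mono fun θ hθ => hLr θ hθ)))
  have hQsub : ∀ θ ∈ subLevel L β δq R ϱ, L θ ≤ L θ₀ + 3 / 2 * δq := fun θ hθ => by
    linarith [hθ.2, havg.2]
  have hQsup : Metric.closedBall θ₀ r ⊆ subLevel L β δq R ϱ := fun θ hθ =>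
    ⟨hball hθ, by linarith [hLr θ hθ, havg.1]⟩
  have hQmeas := (isClosed_subLevel (ϱ := ϱ) hL β δq R).measurableSet
  unfold consensus
  rw [integral_norm_gibbs]
  set ν := quantiled L β δq R ϱ with hν
  set Z := ∫ θ, gibbs G α θ ∂ν with hZ
  have hgi : Integrable (gibbs G α) ν := integrable_quantiled (continuous_gibbs hG α) β δq R
  have hZlow : κ * Real.exp (-α * (Gt + g / 2)) ≤ Z := by
    have hreal : κ ≤ ϱ.real (Metric.closedBall θ₀ r) :=
      (ENNReal.ofReal_le_iff_le_toReal (measure_ne_top _ _)).1 hmass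
    calc κ * Real.exp (-α * (Gt + g / 2))
        ≤ ϱ.real (Metric.closedBall θ₀ r) * Real.exp (-α * (Gt + g / 2)) := by gcongr
      _ = ∫ θ in Metric.closedBall θ₀ r, Real.exp (-α * (Gt + g / 2)) ∂ϱ := by
        rw [setIntegral_const, smul_eq_mul]
      _ ≤ ∫ θ in Metric.closedBall θ₀ r, gibbs G α θ ∂ϱ := by
        refine setIntegral_mono_on (integrable_const _) (hgi.mono_measure
          (Measure.restrict_mono hQsup le_rfl)) Metric.isClosed_closedBall.measurableSet ?_
        intro θ hθ
        refine Real.exp_le_exp.2 ?_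
        have := mul_le_mul_of_nonneg_left (hGr θ hθ) hα
        linarith
      _ ≤ Z := setIntegral_mono_set hgi (ae_of_all _ fun θ => (gibbs_pos α θ).le)
          (ae_of_all _ hQsup)
  have hZpos : 0 < Z := lt_of_lt_of_le (by positivity) hZlow
  have hνle : ν.real univ ≤ 1 := by
    rw [hν, quantiled, measureReal_restrict_apply_univ]
    exact measureReal_le_one
  have hone : ∫ θ, gibbs G α θ / Z ∂ν = 1 := by
    rw [integral_div]
    exact div_self hZpos.ne'
  have hgc := continuous_gibbs hG α
  have hcenter : (∫ θ, (gibbs G α θ / Z) • θ ∂ν) - θ₀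
      = ∫ θ, (gibbs G α θ / Z) • (θ - θ₀) ∂ν := by
    simp_rw [smul_sub]
    rw [integral_sub (integrable_quantiled (by fun_prop) β δq R)
      ((hgi.div_const Z).smul_const θ₀), integral_smul_const, hone, one_smul]
  rw [hcenter]
  -- Bound `‖θ - θ₀‖` by `rG` inside the ball of radius `rG` and by the diameter `2 * R` outside.
  have hbi : Integrable (fun θ => gibbs G α θ / Z * rG
      + 2 * R * Real.exp (-α * (Gt + g)) / Z) ν :=
    ((hgi.div_const Z).mul_const rG).add (integrable_quantiled continuous_const β δq R)
  refine (norm_integral_le_of_norm_le hbi ?_).trans ?_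
  · filter_upwards [ae_restrict_mem hQmeas] with θ hθ
    have hw := div_nonneg (gibbs_pos (G := G) α θ).le hZpos.le
    rw [norm_smul, Real.norm_of_nonneg hw]
    by_cases hθr : θ ∈ Metric.closedBall θ₀ rG
    · have h1 : ‖θ - θ₀‖ ≤ rG := by simpa [dist_eq_norm] using hθr
      have h2 : 0 ≤ 2 * R * Real.exp (-α * (Gt + g)) / Z := by positivity
      have := mul_le_mul_of_nonneg_left h1 hw
      linarith
    · have h1 : gibbs G α θ ≤ Real.exp (-α * (Gt + g)) := by
        refine Real.exp_le_exp.2 ?_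
        have := mul_le_mul_of_nonneg_left (hfar θ (hQsub θ hθ) hθr) hα
        linarith
      have h2 : ‖θ - θ₀‖ ≤ 2 * R := by
        have : ‖θ‖ ≤ R := by simpa using hθ.1
        linarith [norm_sub_le θ θ₀]
      have h3 : 0 ≤ gibbs G α θ / Z * rG := mul_nonneg hw hrG
      calc gibbs G α θ / Z * ‖θ - θ₀‖ ≤ Real.exp (-α * (Gt + g)) / Z * (2 * R) := by gcongr
        _ = 2 * R * Real.exp (-α * (Gt + g)) / Z := by ring
        _ ≤ _ := by linarith
  · rw [integral_add ((hgi.div_const Z).mul_const rG)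
      (integrable_quantiled continuous_const β δq R), integral_mul_const, hone, integral_const,
      one_mul, smul_eq_mul]
    refine add_le_add le_rfl ?_
    calc ν.real univ * (2 * R * Real.exp (-α * (Gt + g)) / Z)
        ≤ 1 * (2 * R * Real.exp (-α * (Gt + g)) / (κ * Real.exp (-α * (Gt + g / 2)))) := by gcongr
      _ = 2 * R / κ * Real.exp (-(g / 2) * α) := by
        have : Real.exp (-α * (Gt + g))
            = Real.exp (-(g / 2) * α) * Real.exp (-α * (Gt + g / 2)) := by
          rw [← Real.exp_add]
          ring_nf
        rw [this]
        field_simp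

end Consensus

/-! ### The mixture weights -/

theorem isProbabilityMeasure_mix {d : ℕ} {wb wm : ℝ} (hwb : 0 ≤ wb) (hwm : 0 ≤ wm)
    (hw : wb + wm = 1) (μ ν : Measure (E d)) [IsProbabilityMeasure μ] [IsProbabilityMeasure ν] :
    IsProbabilityMeasure (mix wb wm μ ν) := by
  constructor
  simp only [mix, Measure.add_apply, Measure.smul_apply, measure_univ, smul_eq_mul, mul_one]
  rw [← ENNReal.ofReal_add hwb hwm, hw, ENNReal.ofReal_one]

theorem ofReal_mul_le_mix {d : ℕ} {wb wm c : ℝ} (hc : 0 ≤ c) {μ ν : Measure (E d)} {S : Set (E d)}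
    (h : ENNReal.ofReal c ≤ μ S) : ENNReal.ofReal (c * wb) ≤ mix wb wm μ ν S := by
  rw [mul_comm, ENNReal.ofReal_mul' hc]
  simp only [mix, Measure.add_apply, Measure.smul_apply, smul_eq_mul]
  exact le_add_right (by gcongr)

/-- The logarithmic term in the threshold for `α` absorbs the factor `1 / wb = 1 + wm / wb`. -/
theorem exp_div_weight_le {u a α wb wm q : ℝ} (hu : 0 < u) (hwb : 0 < wb) (hwm : 0 ≤ wm)
    (hw : wb + wm = 1) (hq : 0 < q) (hα : a + max 0 (Real.log (wm / wb * q)) / u ≤ α) :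
    Real.exp (-u * α) / wb ≤ Real.exp (-u * a) * (1 + 1 / q) := by
  set M := max 0 (Real.log (wm / wb * q)) with hM
  have h1 : u * a + M ≤ u * α := by
    have := mul_le_mul_of_nonneg_left hα hu.le
    rwa [mul_add, mul_div_cancel₀ _ hu.ne'] at this
  have h2 : Real.exp (-u * α) ≤ Real.exp (-u * a) * Real.exp (-M) := by
    rw [← Real.exp_add]
    exact Real.exp_le_exp.2 (by linarith)
  have h3 : Real.exp (-M) ≤ 1 := Real.exp_le_one_iff.2 (neg_nonpos.2 (le_max_left _ _))
  have h4 : Real.exp (-M) * (wm / wb) ≤ 1 / q := by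
    rcases hwm.eq_or_lt with h | h
    · rw [← h, zero_div, mul_zero]
      positivity
    · have hx : 0 < wm / wb * q := by positivity
      have : Real.exp (-M) ≤ (wm / wb * q)⁻¹ := by
        rw [← Real.exp_log hx, ← Real.exp_neg]
        exact Real.exp_le_exp.2 (neg_le_neg (le_max_right _ _))
      calc Real.exp (-M) * (wm / wb) ≤ (wm / wb * q)⁻¹ * (wm / wb) := by gcongr
        _ = 1 / q := by field_simp
  have h5 : 1 / wb = 1 + wm / wb := by
    field_simp
    linarith
  calc Real.exp (-u * α) / wb = Real.exp (-u * α) * (1 + wm / wb) := by rw [← h5]; ring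
    _ ≤ Real.exp (-u * a) * Real.exp (-M) * (1 + wm / wb) := by gcongr
    _ = Real.exp (-u * a) * (Real.exp (-M) + Real.exp (-M) * (wm / wb)) := by ring
    _ ≤ _ := by gcongr

/-! ### The hitting time -/

/-- A function that decays at relative rate `k` up to a relative error `ϑ / 2` reaches the level
`ε` at a time comparable with `log (V 0 / ε) / k`, and decays at rate `(1 - ϑ) k` until then. -/
theorem exists_hitting_time {V V' : ℝ → ℝ} {Ts k ϑ ε : ℝ} (hk : 0 < k) (hϑ : ϑ ∈ Ioo (0 : ℝ) 1)
    (hε : 0 < ε) (h0 : ε < V 0) (hTs : Ts = 1 / ((1 - ϑ) * k) * Real.log (V 0 / ε))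
    (hV : ContinuousOn V (Icc 0 Ts)) (hV' : ∀ t ∈ Ioo 0 Ts, HasDerivAt V (V' t) t)
    (hrate : ∀ t ∈ Ioo 0 Ts, ε ≤ V t → |V' t + k * V t| ≤ ϑ / 2 * k * V t) :
    ∃ T ∈ Icc ((1 - ϑ) / (1 + ϑ / 2) * Ts) Ts, V T = ε ∧
      ∀ t ∈ Icc 0 T, V t ≤ V 0 * Real.exp (-((1 - ϑ) * k) * t) := by
  obtain ⟨hϑ0, hϑ1⟩ := hϑ
  have hk' : 0 < (1 - ϑ) * k := mul_pos (by linarith) hk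
  have hV0 : 0 < V 0 := hε.trans h0
  have hlog : 0 < Real.log (V 0 / ε) := Real.log_pos ((one_lt_div hε).2 h0)
  have hTs0 : 0 < Ts := by rw [hTs]; positivity
  have hdecay : ∀ T ≤ Ts, (∀ t ∈ Ioo 0 T, ε ≤ V t) →
      ∀ t ∈ Icc 0 T, V t ≤ V 0 * Real.exp (-((1 - ϑ) * k) * t) := fun T hT hge =>
    le_mul_exp_of_deriv_le (hV.mono (Icc_subset_Icc_right hT))
      (fun t ht => hV' t ⟨ht.1, ht.2.trans_le hT⟩) fun t ht => by
        have h1 := (abs_le.1 (hrate t ⟨ht.1, ht.2.trans_le hT⟩ (hge t ht))).2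
        have h2 : 0 ≤ ϑ / 2 * k * V t :=
          mul_nonneg (by positivity) (hε.le.trans (hge t ht))
        linarith
  have hend : V 0 * Real.exp (-((1 - ϑ) * k) * Ts) = ε := by
    have : -((1 - ϑ) * k) * Ts = -Real.log (V 0 / ε) := by
      rw [hTs]
      have := hk'.ne'
      field_simp
    rw [this, Real.exp_neg, Real.exp_log (by positivity)]
    field_simp
  have hne : ∃ t ∈ Icc 0 Ts, V t ≤ ε := by
    by_contra hcon
    push Not at hcon
    have h1 := hdecay Ts le_rfl (fun t ht => (hcon t (Ioo_subset_Icc_self ht)).le) Ts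
      ⟨hTs0.le, le_rfl⟩
    rw [hend] at h1
    exact absurd h1 (not_le.2 (hcon Ts ⟨hTs0.le, le_rfl⟩))
  have hclosed : IsClosed (Icc 0 Ts ∩ V ⁻¹' Iic ε) :=
    hV.preimage_isClosed_of_isClosed isClosed_Icc isClosed_Iic
  obtain ⟨T, ⟨hT, hTε⟩, hleast⟩ :=
    (isCompact_Icc.of_isClosed_subset hclosed inter_subset_left).exists_isLeast
      (let ⟨t, ht, h⟩ := hne; ⟨t, ht, h⟩)
  have hbefore : ∀ t ∈ Ico 0 T, ε < V t := fun t ht => by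
    by_contra hcon
    exact absurd (hleast ⟨⟨ht.1, ht.2.le.trans hT.2⟩, not_lt.1 hcon⟩) (not_le.2 ht.2)
  have hTeq : V T = ε := by
    obtain ⟨s, hs, hsε⟩ := intermediate_value_Icc' hT.1 (hV.mono (Icc_subset_Icc_right hT.2))
      ⟨hTε, h0.le⟩
    rcases hs.2.eq_or_lt with h | h
    · rwa [h] at hsε
    · exact absurd hsε (hbefore s ⟨hs.1, h⟩).ne'
  refine ⟨T, ⟨?_, hT.2⟩, hTeq, hdecay T hT.2 fun t ht => (hbefore t ⟨ht.1.le, ht.2⟩).le⟩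
  have hlow := mul_exp_le_of_deriv_ge (hV.mono (Icc_subset_Icc_right hT.2))
    (fun t ht => hV' t ⟨ht.1, ht.2.trans_le hT.2⟩) (k := (1 + ϑ / 2) * k) (fun t ht => by
      have h1 := (abs_le.1 (hrate t ⟨ht.1, ht.2.trans_le hT.2⟩
        (hbefore t ⟨ht.1.le, ht.2⟩).le)).1
      linarith) T ⟨hT.1, le_rfl⟩
  rw [hTeq] at hlow
  have hlog2 : Real.log (V 0 / ε) ≤ (1 + ϑ / 2) * k * T := by
    rw [Real.log_le_iff_le_exp (by positivity), div_le_iff₀ hε]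
    calc V 0 = V 0 * Real.exp (-((1 + ϑ / 2) * k) * T) * Real.exp ((1 + ϑ / 2) * k * T) := by
          rw [mul_assoc, ← Real.exp_add]
          simp
      _ ≤ ε * Real.exp ((1 + ϑ / 2) * k * T) := by gcongr
      _ = _ := mul_comm _ _
  rw [hTs]
  have h1 : (1 - ϑ) ≠ 0 := by linarith
  have e : (1 - ϑ) / (1 + ϑ / 2) * (1 / ((1 - ϑ) * k) * Real.log (V 0 / ε))
      = Real.log (V 0 / ε) / ((1 + ϑ / 2) * k) := by
    have : 1 + ϑ / 2 ≠ 0 := by positivity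
    field_simp
  rw [e, div_le_iff₀ (by positivity)]
  linarith

/-! ### Convergence of the weak solution -/

/-- Sublevel sets of `L` slightly above the minimum lie within distance `rG` of the minimizers. -/
theorem InverseContinuityL.exists_sublevel_subset_nbhd {d : ℕ} {L : E d → ℝ} {θg : E d}
    (h : InverseContinuityL L θg) (hmin : ∀ θ, L θg ≤ L θ) {rG : ℝ} (hrG : 0 < rG) :
    ∃ δ₀ > 0, ∀ θ, L θ ≤ L θg + 3 / 2 * δ₀ → θ ∈ nbhd rG (minimizers L) := by
  obtain ⟨Linf, RL, ηL, νL, hLinf, -, hηL, hνL, hnear, hfar⟩ := h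
  refine ⟨min (2 / 3 * Linf) (2 / 3 * (ηL * rG) ^ (1 / νL)), by positivity, fun θ hθ => ?_⟩
  have h1 : L θ - L θg ≤ Linf := by
    linarith [min_le_left (2 / 3 * Linf) (2 / 3 * (ηL * rG) ^ (1 / νL))]
  have h2 : L θ - L θg ≤ (ηL * rG) ^ (1 / νL) := by
    linarith [min_le_right (2 / 3 * Linf) (2 / 3 * (ηL * rG) ^ (1 / νL))]
  have hmem : θ ∈ nbhd RL (minimizers L) := by
    by_contra hcon
    exact absurd (hfar θ hcon) (not_lt.2 h1)
  have h3 : (L θ - L θg) ^ νL ≤ ηL * rG := by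
    calc (L θ - L θg) ^ νL ≤ ((ηL * rG) ^ (1 / νL)) ^ νL :=
          Real.rpow_le_rpow (sub_nonneg.2 (hmin θ)) h2 hνL.le
      _ = ηL * rG := by
        rw [← Real.rpow_mul (by positivity), one_div, inv_mul_cancel₀ hνL.ne', Real.rpow_one]
  calc Metric.infDist θ (minimizers L) ≤ 1 / ηL * (L θ - L θg) ^ νL := hnear θ hmem
    _ ≤ 1 / ηL * (ηL * rG) := by gcongr
    _ = rG := by field_simp

theorem exists_closedBall_abs_sub_le {d : ℕ} {f : E d → ℝ} (hf : Continuous f) (θ₀ : E d) {η : ℝ}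
    (hη : 0 < η) : ∃ r > 0, ∀ θ ∈ Metric.closedBall θ₀ r, |f θ - f θ₀| ≤ η := by
  obtain ⟨r, hr, h⟩ := Metric.continuous_iff.1 hf θ₀ η hη
  refine ⟨r / 2, by positivity, fun θ hθ => ?_⟩
  have := h θ (lt_of_le_of_lt (Metric.mem_closedBall.1 hθ) (by linarith))
  rw [Real.dist_eq] at this
  exact this.le

/-- If the consensus point stays within a small multiple of `√ε` of `θ₀`, the second moment about
`θ₀` decays until it reaches `2ε`. -/
theorem IsWeakSolution.exists_time_W2sq_eq {d : ℕ} {lam σ ε ϑ c : ℝ} {m : ℝ → E d}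
    {ρ₀ : Measure (E d)} {ρ : ℝ → Measure (E d)} {θ₀ : E d}
    (hw : IsWeakSolution lam σ (horizon θ₀ ρ₀ ε ϑ lam σ) m ρ₀ ρ)
    (hρ : ContinuousInP 4 (horizon θ₀ ρ₀ ε ϑ lam σ) ρ)
    (hε : ε ∈ Ioo 0 (W2sq ρ₀ (Measure.dirac θ₀) / 2))
    (hϑ : ϑ ∈ Ioo (0 : ℝ) 1) (hlam : 0 < lam) (hdrift : d * σ ^ 2 < 2 * lam)
    (hc : 0 ≤ c) (hc1 : c ≤ 1)
    (hcϑ : (2 * lam + 3 * (d * σ ^ 2)) * c ≤ ϑ / 2 * (2 * lam - d * σ ^ 2))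
    (hm : ∀ t ∈ Ioo 0 (horizon θ₀ ρ₀ ε ϑ lam σ), ‖m t - θ₀‖ ≤ c * √ε) :
    ∃ T ∈ Icc ((1 - ϑ) / (1 + ϑ / 2) * horizon θ₀ ρ₀ ε ϑ lam σ) (horizon θ₀ ρ₀ ε ϑ lam σ),
      W2sq (ρ T) (Measure.dirac θ₀) / 2 = ε ∧
      ∀ t ∈ Icc 0 T, W2sq (ρ t) (Measure.dirac θ₀) ≤
        W2sq ρ₀ (Measure.dirac θ₀) * Real.exp (-(1 - ϑ) * (2 * lam - d * σ ^ 2) * t) := by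
  obtain ⟨hε0, hεW⟩ := hε
  obtain ⟨hϑ0, hϑ1⟩ := id hϑ
  have hk : 0 < 2 * lam - d * σ ^ 2 := sub_pos.2 hdrift
  set Ts := horizon θ₀ ρ₀ ε ϑ lam σ with hTs
  have hTs0 : 0 ≤ Ts := by
    have h1 : 0 ≤ 1 - ϑ := by linarith
    refine mul_nonneg (by positivity) (Real.log_nonneg ?_)
    rw [one_le_div (by positivity)]
    linarith
  have hprob := fun t ht => (hρ.1 t ht).1
  have hW : ∀ t ∈ Icc 0 Ts, W2sq (ρ t) (Measure.dirac θ₀) = ∫ θ, ‖θ - θ₀‖ ^ 2 ∂(ρ t) :=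
    fun t ht => by
      have := hprob t ht
      exact W2sq_dirac _ _
  have hW0 : W2sq ρ₀ (Measure.dirac θ₀) = ∫ θ, ‖θ - θ₀‖ ^ 2 ∂(ρ 0) := by
    rw [← hw.initial]
    exact hW 0 ⟨le_rfl, hTs0⟩
  have hB : 0 ≤ c * √ε := by positivity
  obtain ⟨T, hT, hTε, hdecay⟩ := exists_hitting_time (V := fun t => ∫ θ, ‖θ - θ₀‖ ^ 2 ∂(ρ t))
    (ε := 2 * ε) (k := 2 * lam - d * σ ^ 2) hk hϑ (by positivity) (by rw [← hW0]; linarith)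
    (by rw [← hW0, hTs, horizon]) (hρ.continuousOn_secondMoment θ₀)
    (fun t ht => (hw.hasDerivAt_secondMoment θ₀ hρ hlam hB hm ht).2) (fun t ht hV => by
      have := hprob t (Ioo_subset_Icc_self ht)
      obtain ⟨M, hM⟩ := hρ.exists_moment_bound θ₀
      refine (abs_integral_radialGenerator_add_le θ₀ hlam hc hc1 hε0 (hm t ht)
        (integrable_sq_of_integrable_pow_four θ₀ (hM t (Ioo_subset_Icc_self ht)).1)
        (hw.hasDerivAt_secondMoment θ₀ hρ hlam hB hm ht).1 (by linarith)).trans ?_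
      exact mul_le_mul_of_nonneg_right hcϑ (by linarith))
  have hT0 : 0 ≤ T := by
    refine le_trans (mul_nonneg (div_nonneg ?_ ?_) hTs0) hT.1 <;> linarith
  refine ⟨T, hT, ?_, fun t ht => ?_⟩
  · rw [hW T ⟨hT0, hT.2⟩, hTε]
    ring
  · rw [hW t ⟨ht.1, ht.2.trans hT.2⟩, hW0, neg_mul (1 - ϑ)]
    exact hdecay t ht

end CB2O

theorem theorem2p2 (d : ℕ) (L G : CB2O.E d → ℝ) (hL : Continuous L) (hG : Continuous G)
    (θg : CB2O.E d) (RG RGK : ℝ)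
    (h1 : CB2O.UniqueGoodMinimizer L G θg) (h2 : CB2O.HolderAt L θg) (h3 : CB2O.InverseContinuityL L θg)
    (h4 : CB2O.HolderAt G θg) (h5 : CB2O.InverseContinuityG L G θg RG) (h6 : CB2O.GrowthG L G θg RG RGK)
    (ρb₀ : Measure (CB2O.E d)) (hρb₀ : CB2O.InP 4 ρb₀) (hsupp : θg ∈ ρb₀.support)
    (ε ϑ lam σ : ℝ) (hε : ε ∈ Ioo 0 (CB2O.W2sq ρb₀ (Measure.dirac θg) / 2))
    (hϑ : ϑ ∈ Ioo (0 : ℝ) 1) (hlam : 0 < lam) (hσ : 0 < σ) (hdrift : d * σ ^ 2 < 2 * lam) :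
    ∃ u > 0, ∃ δ₀ > 0, ∀ δq : ℝ, 0 < δq → δq ≤ δ₀ → ∀ R : ℝ, ‖θg‖ < R →
      ∃ a > 0, ∃ b > 0, ∀ wb wm : ℝ, 0 < wb → 0 ≤ wm → wb + wm = 1 →
        ∀ α β : ℝ, a + max 0 (Real.log (wm / wb * (RGK / √ε))) / u < α →
          0 < β → β < b * wb →
        ∀ ρm ρb : ℝ → Measure (CB2O.E d),
          CB2O.ContinuousInP 4 (CB2O.horizon θg ρb₀ ε ϑ lam σ) ρm →
          CB2O.ContinuousInP 4 (CB2O.horizon θg ρb₀ ε ϑ lam σ) ρb →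
          CB2O.IsWeakSolution lam σ (CB2O.horizon θg ρb₀ ε ϑ lam σ)
            (fun t => CB2O.consensus L G α β δq R (CB2O.mix wb wm (ρb t) (ρm t))) ρb₀ ρb →
          ContinuousOn
            (fun t => CB2O.consensus L G α β δq R (CB2O.mix wb wm (ρb t) (ρm t)))
            (Icc 0 (CB2O.horizon θg ρb₀ ε ϑ lam σ)) →
          ∃ T ∈ Icc ((1 - ϑ) / (1 + ϑ / 2) * CB2O.horizon θg ρb₀ ε ϑ lam σ)
              (CB2O.horizon θg ρb₀ ε ϑ lam σ),
            CB2O.W2sq (ρb T) (Measure.dirac θg) / 2 = ε ∧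
            ∀ t ∈ Icc 0 T, CB2O.W2sq (ρb t) (Measure.dirac θg) ≤
              CB2O.W2sq ρb₀ (Measure.dirac θg)
                * Real.exp (-(1 - ϑ) * (2 * lam - d * σ ^ 2) * t) := by
  obtain ⟨hε0, hεW⟩ := id hε
  have hmin : ∀ θ, L θg ≤ L θ := h1.1.1
  have hk : 0 < 2 * lam - d * σ ^ 2 := sub_pos.2 hdrift
  have hϑ0 := hϑ.1
  -- The consensus point has to stay within `c₀ √ε` of `θg`.
  set c₀ : ℝ := min 1 (ϑ / 2 * (2 * lam - d * σ ^ 2) / (2 * lam + 3 * (d * σ ^ 2))) with hc₀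
  have hc₀pos : 0 < c₀ := by positivity
  have hc₀ϑ : (2 * lam + 3 * (d * σ ^ 2)) * c₀ ≤ ϑ / 2 * (2 * lam - d * σ ^ 2) := by
    rw [mul_comm, ← le_div_iff₀ (by positivity)]
    exact min_le_right _ _
  set κ : ℝ := c₀ * √ε with hκ
  have hκpos : 0 < κ := by positivity
  obtain ⟨hRG, Ginf, ηG, νG, hGinf, -, -, hinvG⟩ := h5
  obtain ⟨r₁, hr₁, hGr₁⟩ := CB2O.exists_closedBall_abs_sub_le hG θg (η := Ginf / 8) (by positivity)
  -- Inside the ball of radius `rG` the distance to `θg` is at most `κ / 2`; the points outside it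
  -- contribute the other `κ / 2`.
  set rG : ℝ := min (min RG r₁) (κ / 2) with hrG
  have hrGpos : 0 < rG := by positivity
  obtain ⟨θt, hθt, -, hfarG⟩ := hinvG rG hrGpos ((min_le_left _ _).trans (min_le_left _ _))
  have hGr : ∀ θ ∈ Metric.closedBall θg rG, |G θ - G θg| ≤ Ginf / 8 := fun θ hθ =>
    hGr₁ θ (Metric.closedBall_subset_closedBall ((min_le_left _ _).trans (min_le_right _ _)) hθ)
  obtain ⟨δ₀, hδ₀, hsub⟩ := h3.exists_sublevel_subset_nbhd hmin hrGpos
  -- Half of the gap `Ginf` absorbs the oscillation of `G` near `θg`; the other half is the rate `u`.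
  refine ⟨Ginf / 2, by positivity, δ₀, hδ₀, fun δq hδq hδqδ₀ R hR => ?_⟩
  have hR0 : 0 < R := (norm_nonneg _).trans_lt hR
  obtain ⟨r₂, hr₂, hLr₂⟩ := CB2O.exists_closedBall_abs_sub_le hL θg (η := δq / 2) (by positivity)
  set r : ℝ := min (min rG r₂) (R - ‖θg‖) with hr
  have hrpos : 0 < r := lt_min (by positivity) (by linarith)
  -- The consensus point lies in the ball of radius `R`, hence within `2 * R` of `θg`, for all
  -- parameters: the mass bound `c` does not depend on the weights.
  obtain ⟨c, hc, hmass⟩ := CB2O.exists_mass_lower_bound hlam hσ hρb₀.1 hsupp hrpos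
    (B := 2 * R) (by positivity) (CB2O.horizon θg ρb₀ ε ϑ lam σ)
  have hRGK := h6.1
  set q : ℝ := RGK / √ε with hq
  have hqpos : 0 < q := by positivity
  -- `a` is such that `exp (-a u) K ≤ κ / 2`.
  set K : ℝ := 2 * R / c * (1 + 1 / q) with hK
  have hKpos : 0 < K := by positivity
  set a : ℝ := 2 * K / (κ * (Ginf / 2)) with ha
  have hapos : 0 < a := by positivity
  have haK : Real.exp (-(Ginf / 2) * a) * K ≤ κ / 2 := by
    have h1 : 2 * K / κ ≤ Real.exp (Ginf / 2 * a) := by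
      have e : 2 * K / κ = Ginf / 2 * a := by rw [ha]; field_simp
      rw [e]
      linarith [Real.add_one_le_exp (Ginf / 2 * a)]
    rw [neg_mul, Real.exp_neg, inv_mul_le_iff₀ (Real.exp_pos _)]
    rw [div_le_iff₀ hκpos] at h1
    linarith
  refine ⟨a, hapos, c, hc, fun wb wm hwb hwm hw α β hα hβ hβc ρm ρb hρm hρb hweak _ => ?_⟩
  set Ts := CB2O.horizon θg ρb₀ ε ϑ lam σ with hTs
  set m := fun t => CB2O.consensus L G α β δq R (CB2O.mix wb wm (ρb t) (ρm t)) with hm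
  have hα0 : 0 ≤ α := by
    have : 0 ≤ max 0 (Real.log (wm / wb * q)) / (Ginf / 2) := by positivity
    linarith
  have hmix : ∀ t ∈ Icc 0 Ts, IsProbabilityMeasure (CB2O.mix wb wm (ρb t) (ρm t)) :=
    fun t ht => by
      have := (hρb.1 t ht).1
      have := (hρm.1 t ht).1
      exact CB2O.isProbabilityMeasure_mix hwb.le hwm hw _ _
  have hmR : ∀ t ∈ Ioo 0 Ts, ‖m t - θg‖ ≤ 2 * R := fun t ht => by
    have := hmix t (Ioo_subset_Icc_self ht)
    have h1 : ‖m t‖ ≤ R := CB2O.norm_consensus_le hL hG α β δq hR0.le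
    linarith [norm_sub_le (m t) θg]
  have hmκ : ∀ t ∈ Ioo 0 Ts, ‖m t - θg‖ ≤ κ := fun t ht => by
    have := hmix t (Ioo_subset_Icc_self ht)
    have hball : ENNReal.ofReal (c * wb) ≤
        CB2O.mix wb wm (ρb t) (ρm t) (Metric.closedBall θg r) :=
      CB2O.ofReal_mul_le_mix hc.le (hmass m ρb hweak hρb hmR t (Ioo_subset_Icc_self ht))
    have hθtG := abs_le.1 (hGr θt hθt)
    have hlap := CB2O.norm_consensus_sub_le hL hG hmin (r := r) (rG := rG) (Gt := G θt) (g := Ginf)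
      hδq hR.le hrGpos.le hα0 (mul_pos hc hwb) hβ hβc.le
      (Metric.closedBall_subset_closedBall' (by
        rw [dist_zero_right]
        linarith [min_le_right (min rG r₂) (R - ‖θg‖)]))
      (fun θ hθ => by
        have := (abs_le.1 (hLr₂ θ (Metric.closedBall_subset_closedBall
          ((min_le_left _ _).trans (min_le_right _ _)) hθ))).2
        linarith)
      (fun θ hθ => by
        have := (abs_le.1 (hGr θ (Metric.closedBall_subset_closedBall
          ((min_le_left _ _).trans (min_le_left _ _)) hθ))).2
        linarith)
      (fun θ hθ hθr => by
        have := hfarG θ ⟨hsub θ (by linarith), hθr⟩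
        linarith) hball
    refine hlap.trans ?_
    have hwt := CB2O.exp_div_weight_le (u := Ginf / 2) (by positivity) hwb hwm hw hqpos hα.le
    have hrGκ : rG ≤ κ / 2 := min_le_right _ _
    calc rG + 2 * R / (c * wb) * Real.exp (-(Ginf / 2) * α)
        = rG + 2 * R / c * (Real.exp (-(Ginf / 2) * α) / wb) := by field_simp
      _ ≤ rG + 2 * R / c * (Real.exp (-(Ginf / 2) * a) * (1 + 1 / q)) := by gcongr
      _ = rG + Real.exp (-(Ginf / 2) * a) * K := by rw [hK]; ring
      _ ≤ κ := by linarith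
  exact hweak.exists_time_W2sq_eq hρb hε hϑ hlam hdrift hc₀pos.le (min_le_left _ _) hc₀ϑ hmκ
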